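/- All graphs are finite, undirected and simple. For a graph $G$ and a family $\mathcal{X}=\{X_1,\dots,X_p\}$ of non-empty pairwise disjoint subsets of $V(G)$, let $G/\!\!/\mathcal{X}$ be the graph obtained from $G$ by replacing, for each $i$, the set $X_i$ by a single new vertex adjacent to everything that had a neighbour in $X_i$ (without creating loops or multiple edges). The order of $\mathcal{X}$ is $|X_1\cup\dots\cup X_p|$. An instance of the problem Identification to Forest is a pair $(G,k)$ of a graph $G$ and an integer $k\ge 0$; it is a yes-instance if there is such a family $\mathcal{X}$ of order at most $k$ for which $G/\!\!/\mathcal{X}$ is acyclic. Two instances are equivalent if both or neither of them are yes-instances. Theorem. There is an algorithm that, given an instance $(G,k)$ of Identification to Forest, outputs in polynomial time (polynomial in $|V(G)|$ and the number of binary digits of $k$) an equivalent instance $(G',k')$ of Identification to Forest with $k'\le k+1$ and $|V(G')|\le 2k+1$; except that, when $k=0$ and $G$ contains a cycle (where no equivalent instance with $|V(G')|\le 1$ exists), the bound on the number of vertices is $|V(G')|\le 3$. -/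

import Mathlib

/-! ### Identification to a forest -/

section Identification

variable {V : Type*} [DecidableEq V]

/-- The set of vertices of the original graph that a vertex of the identified graph stands for:
an untouched vertex stands for itself, the heir of a part `X` stands for all vertices of `X`. -/
def identifiedClass {S : Finset V} (P : Finpartition S) :
    {v : V // v ∉ S} ⊕ {X : Finset V // X ∈ P.parts} → Finset V
  | .inl v => {v.1}
  | .inr X => X.1

/-- The identification of a partition `P` of a vertex set `S` in `G`: every part `X` is deleted
and replaced by one new vertex (the heir of `X`), which is adjacent to everything that had a
neighbour in `X`.  Loops and multiple edges do not arise, as all graphs are simple. -/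
def SimpleGraph.identify (G : SimpleGraph V) {S : Finset V} (P : Finpartition S) :
    SimpleGraph ({v : V // v ∉ S} ⊕ {X : Finset V // X ∈ P.parts}) where
  Adj a b := a ≠ b ∧ ∃ u ∈ identifiedClass P a, ∃ v ∈ identifiedClass P b, G.Adj u v
  symm := ⟨fun _ _ ⟨hab, u, hu, v, hv, huv⟩ => ⟨hab.symm, v, hv, u, hu, huv.symm⟩⟩
  loopless := ⟨fun _ h => h.1 rfl⟩

/-- `G` admits an identification to a forest of order at most `k`: some partition of a set of at
most `k` vertices of `G` whose identification yields an acyclic graph. -/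
def SimpleGraph.HasForestIdentification (G : SimpleGraph V) (k : ℕ) : Prop :=
  ∃ S : Finset V, S.card ≤ k ∧ ∃ P : Finpartition S, (G.identify P).IsAcyclic

end Identification

/-- An instance `(G, k)` of Identification to Forest; the vertices of `G` are `0, …, n - 1`. -/
structure IdfInstance where
  /-- number of vertices -/
  n : ℕ
  /-- the graph -/
  G : SimpleGraph (Fin n)
  /-- the parameter -/
  k : ℕ

/-- `(G, k)` is a yes-instance of Identification to Forest. -/
def IdfInstance.IsYes (I : IdfInstance) : Prop := I.G.HasForestIdentification I.k

/-- The size of an instance: the number of vertices plus the number of binary digits of `k`. -/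
def IdfInstance.size (I : IdfInstance) : ℕ := I.n + Nat.size I.k

/-! ### Random access machines

A random access machine has registers and two-dimensional arrays, all holding natural numbers.
The arithmetic operations are addition and truncated subtraction (there is no multiplication),
and each operation, each array access and each test costs one unit of time.  In `t` steps, numbers
only grow to a length linear in `t` and the length of the input, so that polynomial time on this
machine is the usual polynomial time. -/

namespace RAM

/-- A memory state: register `x` holds `reg x`, and cell `(i, j)` of array `a` holds
`arr a i j`. -/
structure State where
  /-- the registers -/
  reg : ℕ → ℕ
  /-- the arrays -/
  arr : ℕ → ℕ → ℕ → ℕ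

/-- The state after writing `v` into register `x`. -/
def State.setReg (s : State) (x v : ℕ) : State where
  reg := fun y => if y = x then v else s.reg y
  arr := s.arr

/-- The state after writing `v` into cell `(i, j)` of array `a`. -/
def State.setArr (s : State) (a i j v : ℕ) : State where
  reg := s.reg
  arr := fun a' i' j' => if a' = a ∧ i' = i ∧ j' = j then v else s.arr a' i' j'

/-- Expressions. -/
inductive Expr where
  /-- a literal -/
  | lit (c : ℕ)
  /-- the content of a register -/
  | reg (x : ℕ)
  /-- the content of a cell of an array -/
  | get (a : ℕ) (i j : Expr)
  /-- addition -/
  | add (e f : Expr)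
  /-- truncated subtraction -/
  | sub (e f : Expr)

/-- The value of an expression. -/
def Expr.eval (s : State) : Expr → ℕ
  | .lit c => c
  | .reg x => s.reg x
  | .get a i j => s.arr a (i.eval s) (j.eval s)
  | .add e f => e.eval s + f.eval s
  | .sub e f => e.eval s - f.eval s

/-- The time to evaluate an expression: the number of its operations and operands. -/
def Expr.cost : Expr → ℕ
  | .lit _ => 1
  | .reg _ => 1
  | .get _ i j => 1 + i.cost + j.cost
  | .add e f => 1 + e.cost + f.cost
  | .sub e f => 1 + e.cost + f.cost

/-- Programs. -/
inductive Prog where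
  /-- do nothing -/
  | skip
  /-- register `x` receives the value of `e` -/
  | assign (x : ℕ) (e : Expr)
  /-- cell `(i, j)` of array `a` receives the value of `e` -/
  | store (a : ℕ) (i j e : Expr)
  /-- first `p`, then `q` -/
  | seq (p q : Prog)
  /-- if `e ≠ 0` then `p` else `q` -/
  | ite (e : Expr) (p q : Prog)
  /-- while `e ≠ 0` do `p` -/
  | loop (e : Expr) (p : Prog)

/-- `Exec p s t s'`: started in the state `s`, the program `p` halts after exactly `t` units of
time in the state `s'`. -/
inductive Exec : Prog → State → ℕ → State → Prop where
  | skip (s : State) : Exec .skip s 1 s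
  | assign (s : State) (x : ℕ) (e : Expr) :
      Exec (.assign x e) s (1 + e.cost) (s.setReg x (e.eval s))
  | store (s : State) (a : ℕ) (i j e : Expr) :
      Exec (.store a i j e) s (1 + i.cost + j.cost + e.cost)
        (s.setArr a (i.eval s) (j.eval s) (e.eval s))
  | seq {s s₁ s₂ : State} {t₁ t₂ : ℕ} {p q : Prog} :
      Exec p s t₁ s₁ → Exec q s₁ t₂ s₂ → Exec (.seq p q) s (t₁ + t₂) s₂
  | ite_true {s s₁ : State} {t : ℕ} {e : Expr} {p : Prog} (q : Prog) :
      e.eval s ≠ 0 → Exec p s t s₁ → Exec (.ite e p q) s (1 + e.cost + t) s₁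
  | ite_false {s s₁ : State} {t : ℕ} {e : Expr} (p : Prog) {q : Prog} :
      e.eval s = 0 → Exec q s t s₁ → Exec (.ite e p q) s (1 + e.cost + t) s₁
  | loop_true {s s₁ s₂ : State} {t₁ t₂ : ℕ} {e : Expr} {p : Prog} :
      e.eval s ≠ 0 → Exec p s t₁ s₁ → Exec (.loop e p) s₁ t₂ s₂ →
        Exec (.loop e p) s (1 + e.cost + t₁ + t₂) s₂
  | loop_false {s : State} {e : Expr} (p : Prog) :
      e.eval s = 0 → Exec (.loop e p) s (1 + e.cost) s

open Classical in
/-- The memory state that presents the instance `(G, k)` as input: register `0` holds the number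
of vertices, register `1` holds `k`, array `0` is the adjacency matrix, everything else is `0`. -/
noncomputable def input (I : IdfInstance) : State where
  reg := fun x => if x = 0 then I.n else if x = 1 then I.k else 0
  arr := fun a i j =>
    if a = 0 ∧ ∃ (hi : i < I.n) (hj : j < I.n), I.G.Adj ⟨i, hi⟩ ⟨j, hj⟩ then 1 else 0

open Classical in
/-- The state `s` holds the instance `I` as output: register `0` holds the number of vertices,
register `1` holds `k`, and array `0` holds the adjacency matrix. -/
def Outputs (s : State) (I : IdfInstance) : Prop :=
  s.reg 0 = I.n ∧ s.reg 1 = I.k ∧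
    ∀ i j : Fin I.n, s.arr 0 i j = if I.G.Adj i j then 1 else 0

/-- The map `f` on instances is computed by an algorithm whose running time is bounded by a
polynomial in the size of the instance. -/
def PolyTimeComputable (f : IdfInstance → IdfInstance) : Prop :=
  ∃ (p : Prog) (T : Polynomial ℕ), ∀ I : IdfInstance,
    ∃ (t : ℕ) (s : State), Exec p (input I) t s ∧ t ≤ T.eval I.size ∧ Outputs s (f I)

end RAM

/-! Identifying vertices maps an edge with no end among the identified vertices to an edge, and a detour
around it to a detour.  So the identified vertices of a yes-instance cover all edges that are no
bridges.  Conversely, given a vertex cover of the graph without its bridges, identify the cover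
vertices within each component of that graph: the component becomes a star, and the bridges join the
stars in a tree-like way.  Hence `(G, k)` is a yes-instance exactly if `k` vertices cover the edges
of `G` that are no bridges (`SimpleGraph.hasForestIdentification_iff`).

The kernel is that of Nemhauser and Trotter for Vertex Cover.  Given a half-integral minimum
fractional vertex cover, some minimum vertex cover takes all vertices of value `1` and none of value
`0` (`IsHalfCover.hasCover_iff`; the values are scaled by `2` below).  If the fractional cover has
weight more than `k`, the answer is no, and a triangle with parameter `0` is output.  Otherwise, if
`c` vertices have value `1` and `m` have value `1/2`, then `m ≤ 2 (k - c)`, and it remains to cover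
the graph on the latter with `k - c` vertices.  A new vertex adjacent to all vertices that have a
neighbour puts every edge into a triangle, so that there are no bridges, and raises the cover number
by one if there are edges (`SimpleGraph.cone_hasForestIdentification_iff`).

The fractional cover comes from a maximum matching in the bipartite double cover, found by an
auction: unmatched left vertices bid for their cheapest neighbour and raise its price by one, until
prices reach the limit.  At a price level that does not occur, complementary slackness up to one
yields a vertex cover as large as the matching (`Auction.isHalfCover`).  Every pass of the auction
raises the sum of the prices, which bounds the number of passes.

All loops run through `0, …, N - 1` for the fixed bound `N = n + 3`.  Commands built from such loops
have a denotation as functions on memory states, halt, and take time polynomial in `N`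
(`RAM.Cmd.exec`); what is left is to prove loop invariants for these functions. -/

/-! ### Structured commands -/

namespace RAM

/-- Structured commands: the fragment of `Prog` whose only loops run a register `x` through
`0, …, N - 1`, where `N` is the content of register `2`. -/
inductive Cmd where
  /-- do nothing -/
  | skip
  /-- register `x` receives the value of `e` -/
  | assign (x : ℕ) (e : Expr)
  /-- cell `(i, j)` of array `a` receives the value of `e` -/
  | store (a : ℕ) (i j e : Expr)
  /-- first `c`, then `d` -/
  | seq (c d : Cmd)
  /-- if `e ≠ 0` then `c` else `d` -/
  | ite (e : Expr) (c d : Cmd)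
  /-- `c` for every value of register `x` from `0` to `N - 1` -/
  | loop (x : ℕ) (c : Cmd)

namespace Cmd

/-- The program that a structured command stands for. -/
def toProg : Cmd → Prog
  | skip => .skip
  | assign x e => .assign x e
  | store a i j e => .store a i j e
  | seq c d => .seq c.toProg d.toProg
  | ite e c d => .ite e c.toProg d.toProg
  | .loop x c => .seq (.assign x (.lit 0))
      (.loop (.sub (.reg 2) (.reg x)) (.seq c.toProg (.assign x (.add (.reg x) (.lit 1)))))

/-- The state at the beginning of round `i` of a loop over register `x` whose body acts as `f`. -/
def iter (x : ℕ) (f : State → State) (s : State) : ℕ → State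
  | 0 => s.setReg x 0
  | i + 1 => (f (iter x f s i)).setReg x (i + 1)

/-- The effect of a structured command on the memory. -/
def run : Cmd → State → State
  | skip, s => s
  | assign x e, s => s.setReg x (e.eval s)
  | store a i j e, s => s.setArr a (i.eval s) (j.eval s) (e.eval s)
  | seq c d, s => d.run (c.run s)
  | ite e c d, s => if e.eval s ≠ 0 then c.run s else d.run s
  | .loop x c, s => iter x c.run s (s.reg 2)

theorem run_ite_of_ne {e : Expr} {s : State} (h : e.eval s ≠ 0) (c d : Cmd) :
    (ite e c d).run s = c.run s := if_pos h

theorem run_ite_of_eq {e : Expr} {s : State} (h : e.eval s = 0) (c d : Cmd) :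
    (ite e c d).run s = d.run s := if_neg (not_not.2 h)

/-- The registers that a command may write. -/
def regs : Cmd → List ℕ
  | skip => []
  | assign x _ => [x]
  | store _ _ _ _ => []
  | seq c d => c.regs ++ d.regs
  | ite _ c d => c.regs ++ d.regs
  | .loop x c => x :: c.regs

/-- The arrays that a command may write. -/
def arrs : Cmd → List ℕ
  | skip => []
  | assign _ _ => []
  | store a _ _ _ => [a]
  | seq c d => c.arrs ++ d.arrs
  | ite _ c d => c.arrs ++ d.arrs
  | .loop _ c => c.arrs

/-- No loop body writes the loop register or the register `2` that bounds the loops. -/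
def WF : Cmd → Prop
  | skip => True
  | assign _ _ => True
  | store _ _ _ _ => True
  | seq c d => c.WF ∧ d.WF
  | ite _ c d => c.WF ∧ d.WF
  | .loop x c => x ≠ 2 ∧ x ∉ c.regs ∧ 2 ∉ c.regs ∧ c.WF

/-- A bound on the running time of a command, as a polynomial in the bound `N` of its loops. -/
noncomputable def time : Cmd → Polynomial ℕ
  | skip => 1
  | assign _ e => .C (1 + e.cost)
  | store _ i j e => .C (1 + i.cost + j.cost + e.cost)
  | seq c d => c.time + d.time
  | ite e c d => .C (1 + e.cost) + c.time + d.time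
  | .loop _ c => 6 + .X * (8 + c.time)

theorem iter_induction {x : ℕ} {f : State → State} {s : State} {P : ℕ → State → Prop}
    (h0 : P 0 (s.setReg x 0)) (n : ℕ)
    (hs : ∀ i < n, ∀ s, P i s → P (i + 1) ((f s).setReg x (i + 1))) : P n (iter x f s n) := by
  induction n with
  | zero => exact h0
  | succ n ih => exact hs n (by omega) _ (ih fun i hi => hs i (by omega))

theorem run_reg {c : Cmd} {y : ℕ} (h : y ∉ c.regs) (s : State) : (c.run s).reg y = s.reg y := by
  induction c generalizing s with
  | skip => rfl
  | assign x e => simp_all [regs, run, State.setReg]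
  | store a i j e => rfl
  | seq c d hc hd => simp_all [regs, run]
  | ite e c d hc hd =>
    simp only [regs, List.mem_append, not_or] at h
    simp only [run]; split
    · exact hc h.1 s
    · exact hd h.2 s
  | loop x c hc =>
    simp only [regs, List.mem_cons, not_or] at h
    refine iter_induction (P := fun _ t => t.reg y = s.reg y) ?_ _ fun i _ t ht => ?_
    · simp [State.setReg, h.1]
    · simp [State.setReg, h.1, hc h.2, ht]

theorem run_arr {c : Cmd} {a : ℕ} (h : a ∉ c.arrs) (s : State) : (c.run s).arr a = s.arr a := by
  induction c generalizing s with
  | skip => rfl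
  | assign x e => rfl
  | store b i j e =>
    simp only [arrs, List.mem_singleton] at h
    simp [run, State.setArr, h]
  | seq c d hc hd => simp_all [arrs, run]
  | ite e c d hc hd =>
    simp only [arrs, List.mem_append, not_or] at h
    simp only [run]; split
    · exact hc h.1 s
    · exact hd h.2 s
  | loop x c hc =>
    refine iter_induction (P := fun _ t => t.arr a = s.arr a) rfl _ fun i _ t ht => ?_
    exact (hc h _).trans ht

/-- The invariant rule for loops. -/
theorem run_loop {x : ℕ} {c : Cmd} {s : State} {N : ℕ} (hN : s.reg 2 = N) (P : ℕ → State → Prop)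
    (hwf : (Cmd.loop x c).WF) (h0 : P 0 (s.setReg x 0))
    (hs : ∀ i < N, ∀ s, s.reg 2 = N → s.reg x = i → P i s →
      P (i + 1) ((c.run s).setReg x (i + 1))) :
    P N ((Cmd.loop x c).run s) := by
  subst hN
  obtain ⟨h1, -, h3, -⟩ := hwf
  refine (iter_induction (P := fun i t => t.reg 2 = s.reg 2 ∧ t.reg x = i ∧ P i t)
    ⟨?_, ?_, h0⟩ _ fun i hi t ht => ⟨?_, ?_, hs i hi t ht.1 ht.2.1 ht.2.2⟩).2.2
  · simp [State.setReg, h1.symm]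
  · simp [State.setReg]
  · simp [State.setReg, h1.symm, run_reg h3, ht.1]
  · simp [State.setReg]

/-- Structured commands always halt, within the time bound and with the stated effect. -/
theorem exec {c : Cmd} (h : c.WF) {s : State} {N : ℕ} (hN : s.reg 2 ≤ N) (h2 : 2 ∉ c.regs) :
    ∃ t ≤ c.time.eval N, Exec c.toProg s t (c.run s) := by
  induction c generalizing s with
  | skip => exact ⟨1, by simp [time], .skip s⟩
  | assign x e => exact ⟨_, by simp [time], .assign s x e⟩
  | store a i j e => exact ⟨_, by simp [time], .store s a i j e⟩
  | seq c d hc hd =>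
    simp only [regs, List.mem_append, not_or] at h2
    obtain ⟨t₁, ht₁, e₁⟩ := hc h.1 hN h2.1
    obtain ⟨t₂, ht₂, e₂⟩ := hd (s := c.run s) h.2 (by rwa [run_reg h2.1]) h2.2
    exact ⟨t₁ + t₂, by simpa [time] using add_le_add ht₁ ht₂, .seq e₁ e₂⟩
  | ite e c d hc hd =>
    simp only [regs, List.mem_append, not_or] at h2
    obtain ⟨t₁, ht₁, e₁⟩ := hc h.1 hN h2.1
    obtain ⟨t₂, ht₂, e₂⟩ := hd h.2 hN h2.2
    by_cases he : e.eval s = 0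
    · exact ⟨1 + e.cost + t₂, by simp [time]; omega,
        by simpa [run, toProg, he] using Exec.ite_false c.toProg he e₂⟩
    · exact ⟨1 + e.cost + t₁, by simp [time]; omega,
        by simpa [run, toProg, he] using Exec.ite_true d.toProg he e₁⟩
  | loop x c hc =>
    obtain ⟨h1, hx, h3, hwf⟩ := h
    have inv : ∀ i, (iter x c.run s i).reg 2 = s.reg 2 ∧ (iter x c.run s i).reg x = i := by
      intro i
      refine iter_induction (P := fun i t => t.reg 2 = s.reg 2 ∧ t.reg x = i) ?_ i
        fun i _ t ht => ?_
      · simp [State.setReg, h1.symm]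
      · simp [State.setReg, h1.symm, run_reg h3, ht.1]
    have key : ∀ d i, i + d = s.reg 2 → ∃ t ≤ 4 + d * (8 + c.time.eval N),
        Exec (.loop (.sub (.reg 2) (.reg x)) (.seq c.toProg (.assign x (.add (.reg x) (.lit 1)))))
          (iter x c.run s i) t (iter x c.run s (s.reg 2)) := by
      intro d
      induction d with
      | zero =>
        rintro i rfl
        exact ⟨_, by simp [Expr.cost], .loop_false _ (by simp [Expr.eval, inv])⟩
      | succ d ih =>
        intro i hi
        obtain ⟨t₁, ht₁, e₁⟩ := hc hwf (s := iter x c.run s i) (by rw [(inv i).1]; exact hN) h3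
        obtain ⟨t₂, ht₂, e₂⟩ := ih (i + 1) (by omega)
        have e₃ : Exec (.assign x (.add (.reg x) (.lit 1))) (c.run (iter x c.run s i)) 4
            (iter x c.run s (i + 1)) := by
          have := Exec.assign (c.run (iter x c.run s i)) x (.add (.reg x) (.lit 1))
          simpa [Expr.eval, Expr.cost, run_reg hx, inv, iter] using this
        refine ⟨_, ?_, .loop_true ?_ (.seq e₁ e₃) e₂⟩
        · simp only [Expr.cost]; rw [Nat.succ_mul]; omega
        · simp only [Expr.eval, inv]; omega
    obtain ⟨t, ht, e⟩ := key (s.reg 2) 0 (by omega)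
    refine ⟨_, ?_, .seq (.assign s x (.lit 0)) e⟩
    have := Nat.mul_le_mul_right (8 + c.time.eval N) hN
    simp only [time, Expr.cost, Polynomial.eval_add, Polynomial.eval_mul, Polynomial.eval_X,
      Polynomial.eval_ofNat]
    omega

end Cmd
end RAM

/-! ### Forest identification and bridges -/

namespace SimpleGraph

variable {V : Type*} {G : SimpleGraph V}

theorem Reachable.mem_of_closed {A : Set V} (hA : ∀ x y, G.Adj x y → x ∈ A → y ∈ A) {x y : V}
    (h : G.Reachable x y) (hx : x ∈ A) : y ∈ A := by
  obtain ⟨p⟩ := h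
  induction p with
  | nil => exact hx
  | cons h _ ih => exact ih (hA _ _ h hx)

/-- An edge that is the only one to leave some vertex set is a bridge. -/
theorem isBridge_of_cut {A : Set V} {a b : V} (ha : a ∈ A) (hb : b ∉ A)
    (hA : ∀ x ∈ A, ∀ y ∉ A, G.Adj x y → x = a ∧ y = b) : G.IsBridge s(a, b) := by
  rw [isBridge_iff]
  refine fun h => hb (h.mem_of_closed (fun x y hxy hx => ?_) ha)
  by_contra hy
  simp only [deleteEdges_adj, Set.mem_singleton_iff] at hxy
  obtain ⟨rfl, rfl⟩ := hA x hx y hy hxy.1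
  exact hxy.2 rfl

/-- The graph without its bridges. -/
def core (G : SimpleGraph V) : SimpleGraph V := G.deleteEdges {e | G.IsBridge e}

theorem core_adj {u v : V} : G.core.Adj u v ↔ G.Adj u v ∧ ¬ G.IsBridge s(u, v) := by
  simp [core]

variable [DecidableEq V] {S : Finset V} {P : Finpartition S}

theorem eq_of_mem_identifiedClass {a b : {v : V // v ∉ S} ⊕ {X : Finset V // X ∈ P.parts}} {x : V}
    (ha : x ∈ identifiedClass P a) (hb : x ∈ identifiedClass P b) : a = b := by
  obtain ⟨a, ha'⟩ | ⟨a, ha'⟩ := a <;> obtain ⟨b, hb'⟩ | ⟨b, hb'⟩ := b <;>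
    simp only [identifiedClass, Finset.mem_singleton] at ha hb
  · subst ha; subst hb; rfl
  · subst ha; exact absurd (P.le hb' hb) ha'
  · subst hb; exact absurd (P.le ha' ha) hb'
  · congr; exact P.eq_of_mem_parts ha' hb' ha hb

theorem exists_mem_identifiedClass (P : Finpartition S) (x : V) :
    ∃ a, x ∈ identifiedClass P a := by
  by_cases hx : x ∈ S
  · obtain ⟨X, hX, hx⟩ := P.exists_mem hx
    exact ⟨.inr ⟨X, hX⟩, hx⟩
  · exact ⟨.inl ⟨x, hx⟩, by simp [identifiedClass]⟩

/-- A vertex set that is a union of classes, and that all edges leave between the same two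
classes, makes the edge between these classes a bridge of the identified graph. -/
theorem identify_isBridge_of_cut {D : Set V} {u v : V}
    {a b : {v : V // v ∉ S} ⊕ {X : Finset V // X ∈ P.parts}}
    (hu : u ∈ identifiedClass P a) (hv : v ∈ identifiedClass P b) (huD : u ∈ D) (hvD : v ∉ D)
    (hD : ∀ c, ∀ x ∈ identifiedClass P c, ∀ y ∈ identifiedClass P c, x ∈ D → y ∈ D)
    (hA : ∀ x ∈ D, ∀ y ∉ D, G.Adj x y → x ∈ identifiedClass P a ∧ y ∈ identifiedClass P b) :
    (G.identify P).IsBridge s(a, b) := by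
  refine isBridge_of_cut (A := {c | ∃ x ∈ identifiedClass P c, x ∈ D}) ⟨u, hu, huD⟩ ?_ ?_
  · rintro ⟨x, hx, hxD⟩
    exact hvD (hD b x hx v hv hxD)
  · rintro c ⟨w, hw, hwD⟩ d hd ⟨-, x, hx, y, hy, hxy⟩
    have := hA x (hD c w hw x hx hwD) y (fun hyD => hd ⟨y, hy, hyD⟩) hxy
    exact ⟨eq_of_mem_identifiedClass hx this.1, eq_of_mem_identifiedClass hy this.2⟩

/-- An edge with no end in `S` is an edge of the identified graph, and a detour around the former
maps to a detour around the latter. -/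
theorem mem_or_mem_of_identify_isAcyclic (h : (G.identify P).IsAcyclic) {u v : V}
    (huv : G.core.Adj u v) : u ∈ S ∨ v ∈ S := by
  by_contra! hS
  obtain ⟨hu, hv⟩ := hS
  rw [core_adj, isBridge_iff, not_not] at huv
  let a : {v : V // v ∉ S} ⊕ {X : Finset V // X ∈ P.parts} := .inl ⟨u, hu⟩
  let b : {v : V // v ∉ S} ⊕ {X : Finset V // X ∈ P.parts} := .inl ⟨v, hv⟩
  have hua : u ∈ identifiedClass P a := by simp [a, identifiedClass]
  have hvb : v ∈ identifiedClass P b := by simp [b, identifiedClass]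
  have hab : (G.identify P).Adj a b :=
    ⟨fun h => huv.1.ne (by simpa [a, b] using h), u, hua, v, hvb, huv.1⟩
  have hbr := isAcyclic_iff_forall_adj_isBridge.1 h hab
  rw [isBridge_iff] at hbr
  obtain ⟨c, hc, hr⟩ : v ∈ {x | ∃ c, x ∈ identifiedClass P c ∧
      ((G.identify P).deleteEdges {s(a, b)}).Reachable a c} := by
    refine huv.2.mem_of_closed ?_ ⟨a, hua, Reachable.refl _⟩
    rintro x y hxy ⟨c, hc, hr⟩
    obtain ⟨d, hd⟩ := exists_mem_identifiedClass P y
    refine ⟨d, hd, ?_⟩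
    by_cases hcd : c = d
    · exact hcd ▸ hr
    · refine hr.trans (Adj.reachable ?_)
      simp only [deleteEdges_adj, Set.mem_singleton_iff] at hxy ⊢
      refine ⟨⟨hcd, x, hc, y, hd, hxy.1⟩, fun he => hxy.2 ?_⟩
      rw [Sym2.eq_iff] at he ⊢
      rcases he with ⟨rfl, rfl⟩ | ⟨rfl, rfl⟩ <;>
        simp only [a, b, identifiedClass, Finset.mem_singleton] at hc hd <;> simp [hc, hd]
  rw [eq_of_mem_identifiedClass hc hvb] at hr
  exact hbr hr

/-- Identifying, within every component of the graph without its bridges, the vertices of a vertex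
cover turns this component into a star, and the stars hang together by bridges only. -/
theorem identify_isAcyclic (hS : ∀ u v, G.core.Adj u v → u ∈ S ∨ v ∈ S)
    (hP : ∀ x ∈ S, ∀ y ∈ S, y ∈ P.part x ↔ G.core.Reachable x y) : (G.identify P).IsAcyclic := by
  have hclass : ∀ c, ∀ x ∈ identifiedClass P c, ∀ y ∈ identifiedClass P c,
      x = y ∨ x ∈ S ∧ y ∈ S ∧ G.core.Reachable x y := by
    rintro (c | ⟨X, hX⟩) x hx y hy
    · simp only [identifiedClass, Finset.mem_singleton] at hx hy
      exact .inl (hx.trans hy.symm)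
    · have hxS := P.le hX hx
      have hyS := P.le hX hy
      refine .inr ⟨hxS, hyS, (hP x hxS y hyS).1 ?_⟩
      rwa [P.part_eq_of_mem hX hx]
  have hsame : ∀ x ∈ S, ∀ y ∈ S, G.core.Reachable x y → ∀ c, x ∈ identifiedClass P c →
      y ∈ identifiedClass P c := by
    rintro x hx y hy hxy (⟨c, hcS⟩ | ⟨X, hX⟩) hc
    · simp only [identifiedClass, Finset.mem_singleton] at hc
      exact absurd (hc ▸ hx) hcS
    · change x ∈ X at hc
      have := (hP x hx y hy).2 hxy
      rwa [P.part_eq_of_mem hX hc] at this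
  -- an edge `uv` that is no bridge, where `u` belongs to the cover and `v` does not
  have star : ∀ a b u v, u ∈ identifiedClass P a → v ∈ identifiedClass P b → G.core.Adj u v →
      u ∈ S → v ∉ S → (G.identify P).IsBridge s(a, b) := by
    intro a b u v hu hv huv huS hvS
    -- all that is reachable without `v` from the neighbours that `v` has in its component
    let D : Set V := {w | w ≠ v ∧ ∃ x, G.core.Adj v x ∧ (G.deleteIncidenceSet v).Reachable x w}
    have hstep : ∀ x y, G.Adj x y → x ∈ D → y ≠ v → y ∈ D := by
      rintro x y hxy ⟨hxv, w, hw, hr⟩ hyv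
      refine ⟨hyv, w, hw, hr.trans (Adj.reachable ?_)⟩
      simp [deleteIncidenceSet_adj, hxy, hxv, hyv]
    refine identify_isBridge_of_cut (D := D) hu hv ⟨huv.ne, u, huv.symm, Reachable.refl _⟩
      (fun h => h.1 rfl) ?_ ?_
    · intro c x hx y hy hxD
      rcases hclass c x hx y hy with rfl | ⟨-, hyS, hr⟩
      · exact hxD
      · have : y ∈ D ∪ {v} := by
          refine hr.mem_of_closed (fun p q hpq hp => ?_) (.inl hxD)
          by_cases hq : q = v
          · exact .inr hq
          rcases hp with hp | rfl
          · exact .inl (hstep p q (core_adj.1 hpq).1 hp hq)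
          · exact .inl ⟨hq, q, hpq, Reachable.refl _⟩
        rcases this with h | rfl
        · exact h
        · exact absurd hyS hvS
    · intro x hx y hy hxy
      obtain rfl : y = v := by
        by_contra hyv
        exact hy (hstep x y hxy hx hyv)
      refine ⟨?_, hv⟩
      obtain ⟨hxy', w, hw, hr⟩ := hx
      -- the edge `xy` lies on a cycle through `w`, so it is no bridge
      have hc : G.core.Adj x y := by
        by_cases hwx : w = x
        · exact hwx ▸ hw.symm
        refine core_adj.2 ⟨hxy, fun hbr => (isBridge_iff.1 hbr) ?_⟩
        have h1 : (G.deleteEdges {s(x, y)}).Reachable x w := by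
          refine hr.symm.mono fun p q hpq => ?_
          simp only [deleteIncidenceSet_adj] at hpq
          simp only [deleteEdges_adj, Set.mem_singleton_iff, Sym2.eq_iff]
          exact ⟨hpq.1, by tauto⟩
        refine h1.trans (Adj.reachable ?_)
        simp only [deleteEdges_adj, Set.mem_singleton_iff, Sym2.eq_iff]
        exact ⟨(core_adj.1 hw).1.symm, by have := hw.ne; tauto⟩
      have hxS := (hS x y hc).resolve_right hvS
      exact hsame u huS x hxS (huv.reachable.trans hc.symm.reachable) a hu
  rw [isAcyclic_iff_forall_adj_isBridge]
  rintro a b ⟨hab, u, hu, v, hv, huv⟩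
  by_cases hbr : G.IsBridge s(u, v)
  · refine identify_isBridge_of_cut (D := {w | (G.deleteEdges {s(u, v)}).Reachable u w}) hu hv
      (Reachable.refl _) (isBridge_iff.1 hbr) ?_ ?_
    · intro c x hx y hy hxD
      rcases hclass c x hx y hy with rfl | ⟨-, -, hr⟩
      · exact hxD
      · refine Reachable.trans hxD (hr.mono fun p q hpq => ?_)
        rw [core_adj] at hpq
        simp only [deleteEdges_adj, Set.mem_singleton_iff]
        exact ⟨hpq.1, fun h => hpq.2 (h ▸ hbr)⟩
    · intro x hx y hy hxy
      have : s(x, y) = s(u, v) := by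
        by_contra hne
        refine hy (Reachable.trans hx (Adj.reachable ?_))
        simp [deleteEdges_adj, hxy, hne]
      rcases Sym2.eq_iff.1 this with ⟨rfl, rfl⟩ | ⟨rfl, rfl⟩
      · exact ⟨hu, hv⟩
      · exact absurd (Reachable.refl _) hy
  · have hc : G.core.Adj u v := core_adj.2 ⟨huv, hbr⟩
    by_cases huS : u ∈ S <;> by_cases hvS : v ∈ S
    · exact absurd (eq_of_mem_identifiedClass (hsame u huS v hvS hc.reachable a hu) hv) hab
    · exact star a b u v hu hv hc huS hvS
    · rw [Sym2.eq_swap]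
      exact star b a v u hv hu hc.symm hvS huS
    · exact absurd (hS u v hc) (by tauto)

/-- Identifying to a forest is covering the edges that are no bridges. -/
theorem hasForestIdentification_iff {k : ℕ} : G.HasForestIdentification k ↔
    ∃ S : Finset V, S.card ≤ k ∧ ∀ u v, G.core.Adj u v → u ∈ S ∨ v ∈ S := by
  classical
  constructor
  · rintro ⟨S, hk, P, hP⟩
    exact ⟨S, hk, fun u v => mem_or_mem_of_identify_isAcyclic hP⟩
  · rintro ⟨S, hk, hS⟩
    refine ⟨S, hk, Finpartition.ofSetSetoid G.core.reachableSetoid S,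
      identify_isAcyclic hS fun x hx y hy => ?_⟩
    rw [Finpartition.mem_part_ofSetSetoid_iff_rel]
    exact ⟨fun h => h.2.2, fun h => ⟨hx, hy, h⟩⟩

end SimpleGraph

/-! ### Half-integral vertex covers, auctions and cones -/

/-- The edges of `H` can be covered by at most `k` vertices. -/
def HasCover (H : ℕ → ℕ → Prop) (k : ℕ) : Prop :=
  ∃ S : Finset ℕ, S.card ≤ k ∧ ∀ u v, H u v → u ∈ S ∨ v ∈ S

/-- A half-integral minimum fractional vertex cover of the graph `H` on `0, …, N - 1`, scaled
by `2` to make it integral. -/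
structure IsHalfCover (H : ℕ → ℕ → Prop) (N : ℕ) (x : ℕ → ℕ) : Prop where
  le_two : ∀ v, x v ≤ 2
  cover : ∀ u v, H u v → 2 ≤ x u + x v
  min : ∀ y : ℕ → ℕ, (∀ u v, H u v → 2 ≤ y u + y v) →
    ∑ v ∈ Finset.range N, x v ≤ ∑ v ∈ Finset.range N, y v

namespace IsHalfCover

variable {H : ℕ → ℕ → Prop} {N : ℕ} {x : ℕ → ℕ}

theorem sum_le (h : IsHalfCover H N x) {k : ℕ} (hk : HasCover H k) :
    ∑ v ∈ Finset.range N, x v ≤ 2 * k := by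
  obtain ⟨S, hS, hc⟩ := hk
  refine (h.min (fun v => if v ∈ S then 2 else 0) fun u v huv => ?_).trans ?_
  · rcases hc u v huv with h | h <;> simp [h]
  · rw [← Finset.sum_filter, Finset.sum_const, smul_eq_mul, mul_comm]
    refine Nat.mul_le_mul_left 2 ((Finset.card_le_card fun v hv => ?_).trans hS)
    exact (Finset.mem_filter.1 hv).2

theorem eq_zero (h : IsHalfCover H N x) {v : ℕ} (hv : v < N)
    (hiso : ∀ u w, H u w → u ≠ v ∧ w ≠ v) : x v = 0 := by
  by_contra h0
  refine absurd (h.min (Function.update x v 0) fun u w huw => ?_) (not_le.2 ?_)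
  · rw [Function.update_of_ne (hiso u w huw).1, Function.update_of_ne (hiso u w huw).2]
    exact h.cover u w huw
  · refine Finset.sum_lt_sum (fun w _ => ?_) ⟨v, Finset.mem_range.2 hv, ?_⟩
    · by_cases hw : w = v
      · simp [hw]
      · rw [Function.update_of_ne hw]
    · rw [Function.update_self]
      omega

/-- The theorem of Nemhauser and Trotter: some minimum vertex cover contains all vertices of
value `2` and none of value `0`. -/
theorem hasCover_iff (h : IsHalfCover H N x) (hH : ∀ u v, H u v → u < N ∧ v < N) {k : ℕ} :
    HasCover H (k + ((Finset.range N).filter (x · = 2)).card) ↔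
      HasCover (fun u v => H u v ∧ x u = 1 ∧ x v = 1) k := by
  constructor
  · rintro ⟨S, hS, hc⟩
    refine ⟨(S ∩ Finset.range N).filter (x · = 1), ?_, ?_⟩
    · let y : ℕ → ℕ := fun v =>
        if v ∈ S then (if x v = 0 then 1 else x v) else (if x v = 2 then 1 else x v)
      -- `y` is cheaper than `x` unless the claim holds
      have hy : ∀ u v, H u v → 2 ≤ y u + y v := by
        intro u v huv
        have h1 := h.cover u v huv
        have h2 := hc u v huv
        have h3 := h.le_two u
        have h4 := h.le_two v
        simp only [y]
        split_ifs <;> first | omega | tauto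
      have hmin := h.min y hy
      have hxy : ∀ v, y v + (if v ∉ S ∧ x v = 2 then 1 else 0) =
          x v + (if v ∈ S ∧ x v = 0 then 1 else 0) := by
        intro v
        simp only [y]
        split_ifs <;> first | omega | tauto
      have hsum := Finset.sum_congr (rfl : Finset.range N = Finset.range N) fun v _ => hxy v
      rw [Finset.sum_add_distrib, Finset.sum_add_distrib, ← Finset.card_filter,
        ← Finset.card_filter] at hsum
      have e1 : ((Finset.range N).filter (x · = 2)).card =
          ((Finset.range N).filter fun v => v ∉ S ∧ x v = 2).card +
          ((S ∩ Finset.range N).filter fun v => x v = 2).card := by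
        rw [← Finset.card_union_of_disjoint]
        · congr 1; ext v; simp only [Finset.mem_filter, Finset.mem_union, Finset.mem_inter]; tauto
        · rw [Finset.disjoint_left]; simp only [Finset.mem_filter, Finset.mem_inter]; tauto
      have e2 : ((Finset.range N).filter fun v => v ∈ S ∧ x v = 0).card =
          ((S ∩ Finset.range N).filter fun v => x v = 0).card := by
        congr 1; ext v; simp only [Finset.mem_filter, Finset.mem_inter]; tauto
      have e3 : ((S ∩ Finset.range N).filter (x · = 1)).card +
          ((S ∩ Finset.range N).filter (x · = 2)).card +
          ((S ∩ Finset.range N).filter (x · = 0)).card ≤ S.card := by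
        rw [← Finset.card_union_of_disjoint, ← Finset.card_union_of_disjoint]
        · refine Finset.card_le_card fun v => ?_
          simp only [Finset.mem_filter, Finset.mem_union, Finset.mem_inter]; tauto
        · rw [Finset.disjoint_left]
          simp only [Finset.mem_filter, Finset.mem_union, Finset.mem_inter]
          rintro v (h | h) <;> omega
        · rw [Finset.disjoint_left]
          simp only [Finset.mem_filter, Finset.mem_inter]
          intro v h; omega
      omega
    · rintro u v ⟨huv, hu, hv⟩
      have := hH u v huv
      simp only [Finset.mem_filter, Finset.mem_inter, Finset.mem_range]
      have := hc u v huv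
      tauto
  · rintro ⟨S, hS, hc⟩
    refine ⟨S ∪ (Finset.range N).filter (x · = 2),
      (Finset.card_union_le _ _).trans (Nat.add_le_add_right hS _), fun u v huv => ?_⟩
    have h1 := h.cover u v huv
    have h2 := hH u v huv
    have h3 := h.le_two u
    have h4 := h.le_two v
    simp only [Finset.mem_union, Finset.mem_filter, Finset.mem_range]
    by_cases hu : x u = 2
    · tauto
    by_cases hv : x v = 2
    · tauto
    have := hc u v ⟨huv, by omega, by omega⟩
    tauto

end IsHalfCover

/-- The state of an auction for a maximum matching in the bipartite double cover of `H`.  The value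
`mL u = v + 1`, or equally `mR v = u + 1`, says that the left copy of `u` is matched to the right
copy of `v`, and `0` says that a vertex is not matched; `p v` is the price of the right copy of
`v`.  A matched vertex pays at most one more than the least price of a neighbour. -/
structure Auction (H : ℕ → ℕ → Prop) (N : ℕ) (mL mR p : ℕ → ℕ) : Prop where
  mate : ∀ u v, mL u = v + 1 ↔ mR v = u + 1
  adj : ∀ u v, mL u = v + 1 → H u v
  slack : ∀ u v w, mL u = v + 1 → H u w → p v ≤ p w + 1
  free : ∀ v, mR v = 0 → p v = 0
  le : ∀ v, p v ≤ N

namespace Auction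

variable {H : ℕ → ℕ → Prop} {N : ℕ} {mL mR p : ℕ → ℕ}

/-- The auction is over once every unmatched vertex finds all its neighbours at the price limit. -/
def Over (H : ℕ → ℕ → Prop) (N : ℕ) (mL p : ℕ → ℕ) : Prop :=
  ∀ u v, mL u = 0 → H u v → N ≤ p v

theorem init (H : ℕ → ℕ → Prop) (N : ℕ) : Auction H N (fun _ => 0) (fun _ => 0) (fun _ => 0) where
  mate := by simp
  adj := by simp
  slack := by simp
  free := by simp
  le := by simp

/-- An unmatched vertex takes its cheapest neighbour, from whoever has it, and raises its price. -/
theorem bid (h : Auction H N mL mR p) {u v : ℕ} (hu : mL u = 0) (huv : H u v) (hv : p v < N)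
    (hmin : ∀ w, H u w → p v ≤ p w) {mL' mR' p' : ℕ → ℕ}
    (hL : ∀ w, mL' w = if w = u then v + 1 else if mR v = w + 1 then 0 else mL w)
    (hR : ∀ w, mR' w = if w = v then u + 1 else mR w)
    (hp : ∀ w, p' w = if w = v then p v + 1 else p w) : Auction H N mL' mR' p' where
  mate a b := by have := h.mate a b; have := h.mate a v; have := h.mate u b; grind
  adj a b hab := by have := h.adj a b; grind
  slack a b w hab hw := by
    have := h.slack a b w; have := hmin w; have := h.mate a b; grind
  free b hb := by have := h.free b; grind
  le b := by have := h.le b; grind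

theorem sum_bid {v : ℕ} (hv : v < N) {p' : ℕ → ℕ}
    (hp : ∀ w, p' w = if w = v then p v + 1 else p w) :
    ∑ w ∈ Finset.range N, p' w = ∑ w ∈ Finset.range N, p w + 1 := by
  have : ∀ w, p' w = p w + if w = v then 1 else 0 := by
    intro w; rw [hp]; split_ifs with h
    · rw [h]
    · rfl
  rw [Finset.sum_congr rfl fun w _ => this w, Finset.sum_add_distrib]
  simp [hv]

/-- Some price level is missed when some vertex has price `0`. -/
theorem exists_level {n : ℕ} (hn : n < N) (hp : p n = 0) :
    ∃ l < N, ∀ v < N, p v ≠ l + 1 := by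
  by_contra! h
  have : Finset.Icc 1 N ⊆ ((Finset.range N).erase n).image p := by
    intro l hl
    rw [Finset.mem_Icc] at hl
    obtain ⟨v, hv, hvl⟩ := h (l - 1) (by omega)
    rw [Finset.mem_image]
    refine ⟨v, ?_, by omega⟩
    rw [Finset.mem_erase, Finset.mem_range]
    refine ⟨?_, hv⟩
    rintro rfl
    omega
  have := (Finset.card_le_card this).trans Finset.card_image_le
  rw [Finset.card_erase_of_mem (Finset.mem_range.2 hn)] at this
  simp at this
  omega

/-- When the auction is over and no right vertex has price `l`, the right vertices of higher price
and the left vertices matched to right vertices of lower price cover the double cover of `H`, and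
each of them is an end of a matching edge of its own.  Adding up the two copies of every vertex,
we get a minimum fractional vertex cover. -/
theorem isHalfCover (h : Auction H N mL mR p) (ho : Over H N mL p)
    (hsymm : ∀ u v, H u v → H v u) (hH : ∀ u v, H u v → v < N) {l : ℕ} (hlN : l ≤ N)
    (hl : ∀ v < N, p v ≠ l) :
    IsHalfCover H N fun v =>
      (if l < p v then 1 else 0) + if mL v ≠ 0 ∧ p (mL v - 1) < l then 1 else 0 where
  le_two v := by split_ifs <;> omega
  cover := by
    have key : ∀ u v, H u v → l < p v ∨ mL u ≠ 0 ∧ p (mL u - 1) < l := by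
      intro u v huv
      by_contra! hc
      have h1 := hl v (hH u v huv)
      by_cases hu : mL u = 0
      · have := ho u v hu huv
        omega
      · obtain ⟨w, hw⟩ := Nat.exists_eq_succ_of_ne_zero hu
        have h2 := h.slack u w v hw huv
        have h3 := hc.2 hu
        have h4 := hl w (hH u w (h.adj u w hw))
        simp only [hw, Nat.succ_sub_one] at h3
        omega
    intro u v huv
    have h1 := key u v huv
    have h2 := key v u (hsymm u v huv)
    split_ifs <;> omega
  min y hy := by
    classical
    let M := (Finset.range N).filter fun u => mL u ≠ 0
    let q : ℕ → ℕ := fun u => mL u - 1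
    have hq : ∀ u ∈ M, mL u = q u + 1 := by
      intro u hu
      have := (Finset.mem_filter.1 hu).2
      simp only [q]; omega
    have hqN : ∀ u ∈ M, q u ∈ Finset.range N := fun u hu =>
      Finset.mem_range.2 (hH u _ (h.adj u _ (hq u hu)))
    have hinj : Set.InjOn q M := by
      intro u hu w hw huw
      have h1 := (h.mate u _).1 (hq u hu)
      have h2 := (h.mate w _).1 (hq w hw)
      rw [huw] at h1
      omega
    have hlow : ∑ u ∈ Finset.range N, (if mL u ≠ 0 ∧ p (mL u - 1) < l then 1 else 0) =
        (M.filter fun u => p (q u) < l).card := by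
      rw [← Finset.card_filter, Finset.filter_filter]
    have hhigh : ∑ v ∈ Finset.range N, (if l < p v then 1 else 0) ≤
        (M.filter fun u => ¬ p (q u) < l).card := by
      rw [← Finset.card_filter, ← Finset.card_image_of_injOn (s := M.filter _)
        (hinj.mono (Finset.coe_subset.2 (Finset.filter_subset _ _)))]
      refine Finset.card_le_card fun v hv => ?_
      obtain ⟨hv, hlv⟩ := Finset.mem_filter.1 hv
      have : mR v ≠ 0 := fun h0 => by have := h.free v h0; omega
      obtain ⟨u, hu⟩ := Nat.exists_eq_succ_of_ne_zero this
      have hu' := (h.mate u v).2 hu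
      have hquv : q u = v := by simp [q, hu']
      have huN : u < N := hH v u (hsymm _ _ (h.adj u v hu'))
      refine Finset.mem_image.2 ⟨u, ?_, hquv⟩
      simp only [M, Finset.mem_filter, Finset.mem_range, hquv]
      exact ⟨⟨huN, by omega⟩, by omega⟩
    have h1 : ∑ u ∈ M, 2 ≤ ∑ u ∈ M, (y u + y (q u)) :=
      Finset.sum_le_sum fun u hu => hy u _ (h.adj u _ (hq u hu))
    have h2 : ∑ u ∈ M, y u ≤ ∑ u ∈ Finset.range N, y u :=
      Finset.sum_le_sum_of_subset (Finset.filter_subset _ _)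
    have h3 : ∑ u ∈ M, y (q u) ≤ ∑ u ∈ Finset.range N, y u := by
      rw [← Finset.sum_image (f := y) hinj]
      exact Finset.sum_le_sum_of_subset (Finset.image_subset_iff.2 hqN)
    have h4 := Finset.card_filter_add_card_filter_not (s := M) fun u => p (q u) < l
    rw [Finset.sum_add_distrib] at h1 ⊢
    rw [Finset.sum_const, smul_eq_mul] at h1
    omega

end Auction

namespace SimpleGraph

variable {n : ℕ}

/-- The edges of `G` that are no bridges, as a relation on natural numbers. -/
def coreRel (G : SimpleGraph (Fin n)) (a b : ℕ) : Prop :=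
  ∃ (ha : a < n) (hb : b < n), G.core.Adj ⟨a, ha⟩ ⟨b, hb⟩

theorem coreRel_symm {G : SimpleGraph (Fin n)} {a b : ℕ} : G.coreRel a b → G.coreRel b a :=
  fun ⟨ha, hb, h⟩ => ⟨hb, ha, h.symm⟩

theorem hasForestIdentification_iff_hasCover {G : SimpleGraph (Fin n)} {k : ℕ} :
    G.HasForestIdentification k ↔ HasCover G.coreRel k := by
  rw [hasForestIdentification_iff]
  constructor
  · rintro ⟨S, hk, hS⟩
    refine ⟨S.map Fin.valEmbedding, by rwa [Finset.card_map], ?_⟩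
    rintro u v ⟨hu, hv, h⟩
    have := hS _ _ h
    exact this.imp (fun h => Finset.mem_map.2 ⟨_, h, rfl⟩) fun h => Finset.mem_map.2 ⟨_, h, rfl⟩
  · rintro ⟨S, hk, hS⟩
    refine ⟨Finset.univ.filter fun i : Fin n => (i : ℕ) ∈ S, le_trans ?_ hk, fun u v h => ?_⟩
    · refine Finset.card_le_card_of_injOn (fun i => (i : ℕ)) (fun i hi => ?_)
        (Fin.val_injective.injOn)
      simpa using hi
    · simpa using hS u v ⟨u.2, v.2, h⟩

/-- An edge of a triangle is no bridge. -/
theorem core_adj_of_triangle {V : Type*} {G : SimpleGraph V} {u v w : V} (huv : G.Adj u v)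
    (huw : G.Adj u w) (hvw : G.Adj v w) : G.core.Adj u v := by
  refine core_adj.2 ⟨huv, fun h => isBridge_iff.1 h ?_⟩
  refine (Adj.reachable (v := w) ?_).trans (Adj.reachable ?_)
  · simp [deleteEdges_adj, huw, hvw.ne', huv.ne]
  · simp [deleteEdges_adj, hvw.symm, huw.ne', huv.ne']

theorem not_hasForestIdentification_triangle :
    ¬ (⊤ : SimpleGraph (Fin 3)).HasForestIdentification 0 := by
  rw [hasForestIdentification_iff]
  rintro ⟨S, hS, h⟩
  have := h 0 1 (core_adj_of_triangle (w := 2) (by simp) (by simp) (by simp))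
  simp_all

/-- The graph on `0, …, m` with the edges of `H` and with the vertex `m` adjacent to every vertex
that has a neighbour. -/
def cone (H : ℕ → ℕ → Prop) (m : ℕ) : SimpleGraph (Fin (m + 1)) :=
  fromRel fun i j => i < m ∧ (j < m ∧ H i j ∨ (j : ℕ) = m ∧ ∃ a < m, H i a)

theorem cone_adj {H : ℕ → ℕ → Prop} (hs : ∀ u v, H u v → H v u) (hi : ∀ u, ¬ H u u) {m : ℕ}
    {i j : Fin (m + 1)} : (cone H m).Adj i j ↔ i < m ∧ j < m ∧ H i j ∨
      i < m ∧ (j : ℕ) = m ∧ (∃ a < m, H i a) ∨ j < m ∧ (i : ℕ) = m ∧ ∃ a < m, H j a := by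
  rw [cone, fromRel_adj]
  constructor
  · rintro ⟨hne, (⟨h1, h2 | h2⟩ | ⟨h1, h2 | h2⟩)⟩
    · exact .inl ⟨h1, h2⟩
    · exact .inr (.inl ⟨h1, h2⟩)
    · exact .inl ⟨h2.1, h1, hs _ _ h2.2⟩
    · exact .inr (.inr ⟨h1, h2⟩)
  · rintro (h | h | h)
    · exact ⟨fun he => hi i (by simpa [he] using h.2.2), .inl ⟨h.1, .inl h.2⟩⟩
    · exact ⟨fun he => by have := h.1; rw [he, h.2.1] at this; omega, .inl ⟨h.1, .inr h.2⟩⟩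
    · exact ⟨fun he => by have := h.1; rw [← he, h.2.1] at this; omega, .inr ⟨h.1, .inr h.2⟩⟩

/-- All edges of the cone lie in triangles, so that none is a bridge; and the apex costs exactly
one more vertex in a cover, as a cover without the apex contains all vertices that have a
neighbour, one more than needed. -/
theorem cone_hasForestIdentification_iff {H : ℕ → ℕ → Prop} (hs : ∀ u v, H u v → H v u)
    (hi : ∀ u, ¬ H u u) {m k : ℕ} : (cone H m).HasForestIdentification (k + 1) ↔
      HasCover (fun u v => u < m ∧ v < m ∧ H u v) k := by
  have hcore : ∀ i j, (cone H m).Adj i j → (cone H m).core.Adj i j := by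
    have hap : ∀ i : Fin (m + 1), i < m → (∃ a < m, H i a) →
        (cone H m).core.Adj i (Fin.last m) := by
      rintro i hi' ⟨a, ha, hia⟩
      refine core_adj_of_triangle (w := ⟨a, by omega⟩) ?_ ?_ ?_ <;> rw [cone_adj hs hi]
      · exact .inr (.inl ⟨hi', rfl, a, ha, hia⟩)
      · exact .inl ⟨hi', ha, hia⟩
      · exact .inr (.inr ⟨ha, rfl, i, hi', hs _ _ hia⟩)
    intro i j h
    rcases (cone_adj hs hi).1 h with ⟨h1, h2, h3⟩ | ⟨h1, h2, h3⟩ | ⟨h1, h2, h3⟩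
    · exact core_adj_of_triangle h (core_adj.1 (hap i h1 ⟨j, h2, h3⟩)).1
        (core_adj.1 (hap j h2 ⟨i, h1, hs _ _ h3⟩)).1
    · rw [show j = Fin.last m from Fin.ext h2]
      exact hap i h1 h3
    · rw [show i = Fin.last m from Fin.ext h2]
      exact (hap j h1 h3).symm
  rw [hasForestIdentification_iff_hasCover]
  have hadj : ∀ a b, a < m ∧ b < m ∧ H a b → (cone H m).coreRel a b := fun a b ⟨ha, hb, h⟩ =>
    ⟨by omega, by omega, hcore _ _ ((cone_adj hs hi).2 (.inl ⟨ha, hb, h⟩))⟩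
  have hapex : ∀ a b, a < m ∧ b < m ∧ H a b → (cone H m).coreRel a m := fun a b ⟨ha, hb, h⟩ =>
    ⟨by omega, by omega, hcore _ _ ((cone_adj hs hi).2 (.inr (.inl ⟨ha, rfl, b, hb, h⟩)))⟩
  constructor
  · rintro ⟨S, hk, hS⟩
    by_cases hm : m ∈ S
    · refine ⟨S.erase m, by rw [Finset.card_erase_of_mem hm]; omega, fun u v h => ?_⟩
      have := hS u v (hadj u v h)
      simp only [Finset.mem_erase]
      have := h.1.ne
      have := h.2.1.ne
      tauto
    · have hmem : ∀ a b, a < m ∧ b < m ∧ H a b → a ∈ S := fun a b h =>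
        (hS a m (hapex a b h)).resolve_right hm
      by_cases hne : ∃ a b, a < m ∧ b < m ∧ H a b
      · obtain ⟨a, b, hab⟩ := hne
        refine ⟨S.erase a, by rw [Finset.card_erase_of_mem (hmem a b hab)]; omega,
          fun u v h => ?_⟩
        have h1 := hmem u v h
        have h2 := hmem v u ⟨h.2.1, h.1, hs _ _ h.2.2⟩
        have h3 : u ≠ v := by rintro rfl; exact hi _ h.2.2
        simp only [Finset.mem_erase]
        by_cases hu : u = a
        · exact .inr ⟨fun hv => h3 (hu.trans hv.symm), h2⟩
        · exact .inl ⟨hu, h1⟩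
      · exact ⟨∅, by simp, fun u v h => absurd ⟨u, v, h⟩ hne⟩
  · rintro ⟨S, hk, hS⟩
    refine ⟨insert m S, (Finset.card_insert_le _ _).trans (by omega), ?_⟩
    rintro u v ⟨hu, hv, h⟩
    rw [core_adj, cone_adj hs hi] at h
    rcases h.1 with h | h | h
    · have := hS u v h
      simp only [Finset.mem_insert]; tauto
    · have : v = m := h.2.1
      simp [this]
    · have : u = m := h.2.1
      simp [this]

end SimpleGraph

/-- Renaming the vertices that may have neighbours does not change the covers. -/
theorem hasCover_comp_iff {H : ℕ → ℕ → Prop} {m : ℕ} {f : ℕ → ℕ} (hf : Set.InjOn f (Set.Iio m))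
    (hH : ∀ u v, H u v → (∃ i < m, f i = u) ∧ ∃ i < m, f i = v) {k : ℕ} :
    HasCover (fun i j => i < m ∧ j < m ∧ H (f i) (f j)) k ↔ HasCover H k := by
  constructor
  · rintro ⟨S, hk, hS⟩
    refine ⟨S.image f, Finset.card_image_le.trans hk, fun u v h => ?_⟩
    obtain ⟨⟨i, hi, rfl⟩, j, hj, rfl⟩ := hH u v h
    have := hS i j ⟨hi, hj, h⟩
    exact this.imp (Finset.mem_image_of_mem f) (Finset.mem_image_of_mem f)
  · rintro ⟨S, hk, hS⟩
    refine ⟨(Finset.range m).filter (f · ∈ S), le_trans ?_ hk, fun i j h => ?_⟩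
    · refine Finset.card_le_card_of_injOn f (fun i hi => ?_) (hf.mono fun i hi => ?_)
      · exact (Finset.mem_filter.1 hi).2
      · simpa using (Finset.mem_filter.1 hi).1
    · have := hS _ _ h.2.2
      simp only [Finset.mem_filter, Finset.mem_range]
      tauto

/-! ### Computing the edges that are no bridges -/

namespace RAM

/-- An expression that is nonzero exactly if `e` and `f` differ. -/
def Expr.ne (e f : Expr) : Expr := .add (.sub e f) (.sub f e)

@[simp]
theorem Expr.eval_ne_eq_zero {e f : Expr} {s : State} :
    (e.ne f).eval s = 0 ↔ e.eval s = f.eval s := by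
  simp only [Expr.ne, Expr.eval]; omega

/-- The entry `i` of the array `a`, used as a vector. -/
def Expr.vec (a : ℕ) (i : Expr) : Expr := .get a i (.lit 0)

@[simp]
theorem Expr.eval_vec {a : ℕ} {i : Expr} {s : State} :
    (Expr.vec a i).eval s = s.arr a (i.eval s) 0 := rfl

namespace Cmd

@[simp]
theorem setReg_arr (s : State) (x v : ℕ) : (s.setReg x v).arr = s.arr := rfl

@[simp]
theorem setArr_reg (s : State) (a i j v : ℕ) : (s.setArr a i j v).reg = s.reg := rfl

/-- Vector `2` receives the characteristic vector of the content of register `3`. -/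
def mark : Cmd :=
  .seq (.loop 5 (.store 2 (.reg 5) (.lit 0) (.lit 0))) (.store 2 (.reg 3) (.lit 0) (.lit 1))

/-- Vector `2`, a set of vertices, receives the neighbours of its members in array `0`, except
along the edge between the contents of registers `3` and `4`. -/
def relax : Cmd :=
  .loop 6 <| .loop 7 <| .ite (.vec 2 (.reg 6)) (.ite (.get 0 (.reg 6) (.reg 7))
    (.ite (.add (.ne (.reg 6) (.reg 3)) (.ne (.reg 7) (.reg 4)))
      (.store 2 (.reg 7) (.lit 0) (.lit 1)) .skip) .skip) .skip

/-- Vector `2` receives the vertices that the content of register `3` is connected to without the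
edge to the content of register `4`. -/
def reach : Cmd := .seq mark (.loop 5 relax)

/-- Array `1` receives the edges of the graph in array `0` that are no bridges. -/
def core : Cmd :=
  .loop 3 <| .loop 4 <| .ite (.get 0 (.reg 3) (.reg 4))
    (.seq reach (.store 1 (.reg 3) (.reg 4) (.vec 2 (.reg 4)))) .skip

theorem mark_spec {s : State} {N : ℕ} (hN : s.reg 2 = N) {b : ℕ} (hb : b < N) :
    (mark.run s).arr 2 b 0 ≠ 0 ↔ b = s.reg 3 := by
  have h := run_loop hN (x := 5) (c := .store 2 (.reg 5) (.lit 0) (.lit 0))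
    (fun i t => t.reg 3 = s.reg 3 ∧ ∀ b < i, t.arr 2 b 0 = 0)
    (by simp [WF, regs]) (by simp [State.setReg]) fun i _ t _ hx ht => by
      refine ⟨by simp [State.setReg, run, ht.1], fun b hb => ?_⟩
      have := ht.2 b
      simp only [setReg_arr, run, Expr.eval, State.setArr, hx]
      grind
  have h1 := h.1
  have h2 := h.2 b hb
  simp only [mark, run, Expr.eval, State.setArr] at h1 h2 ⊢
  rw [h1]
  grind

/-- One round adds all neighbours, and it adds nothing that a closed set would not contain. -/
theorem relax_spec {s : State} {N : ℕ} (hN : s.reg 2 = N) :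
    (∀ b, s.arr 2 b 0 ≠ 0 → (relax.run s).arr 2 b 0 ≠ 0) ∧
    (∀ a < N, ∀ b < N, s.arr 2 a 0 ≠ 0 → s.arr 0 a b ≠ 0 → (a ≠ s.reg 3 ∨ b ≠ s.reg 4) →
      (relax.run s).arr 2 b 0 ≠ 0) ∧
    ∀ A : ℕ → Prop, (∀ a b, A a → s.arr 0 a b ≠ 0 → (a ≠ s.reg 3 ∨ b ≠ s.reg 4) → A b) →
      (∀ b, s.arr 2 b 0 ≠ 0 → A b) → ∀ b, (relax.run s).arr 2 b 0 ≠ 0 → A b := by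
  let Q : (ℕ → ℕ → Prop) → State → Prop := fun T t =>
    t.reg 3 = s.reg 3 ∧ t.reg 4 = s.reg 4 ∧ t.arr 0 = s.arr 0 ∧
    (∀ b, s.arr 2 b 0 ≠ 0 → t.arr 2 b 0 ≠ 0) ∧
    (∀ a b, T a b → s.arr 2 a 0 ≠ 0 → s.arr 0 a b ≠ 0 → (a ≠ s.reg 3 ∨ b ≠ s.reg 4) →
      t.arr 2 b 0 ≠ 0) ∧
    ∀ A : ℕ → Prop, (∀ a b, A a → s.arr 0 a b ≠ 0 → (a ≠ s.reg 3 ∨ b ≠ s.reg 4) → A b) →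
      (∀ b, s.arr 2 b 0 ≠ 0 → A b) → ∀ b, t.arr 2 b 0 ≠ 0 → A b
  suffices h : Q (fun a b => a < N ∧ b < N) (relax.run s) by
    exact ⟨h.2.2.2.1, fun a ha b hb => h.2.2.2.2.1 a b ⟨ha, hb⟩, h.2.2.2.2.2⟩
  refine run_loop hN (fun i t => Q (fun a b => a < i ∧ b < N) t) (by simp [WF, regs])
    ⟨by simp [State.setReg], by simp [State.setReg], rfl, by simp, by simp,
      fun A _ h => by simpa using h⟩ fun i hi t ht hx hQ => ?_
  suffices h : Q (fun a b => a < i + 1 ∧ b < N)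
      ((Cmd.loop 7 (.ite (.vec 2 (.reg 6)) (.ite (.get 0 (.reg 6) (.reg 7))
        (.ite (.add (.ne (.reg 6) (.reg 3)) (.ne (.reg 7) (.reg 4)))
          (.store 2 (.reg 7) (.lit 0) (.lit 1)) .skip) .skip) .skip)).run t) by
    simpa [Q, State.setReg] using h
  have := run_loop ht (fun j t => t.reg 6 = i ∧ Q (fun a b => a < i ∧ b < N ∨ a = i ∧ b < j) t)
    (x := 7) (c := .ite (.vec 2 (.reg 6)) (.ite (.get 0 (.reg 6) (.reg 7))
        (.ite (.add (.ne (.reg 6) (.reg 3)) (.ne (.reg 7) (.reg 4)))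
          (.store 2 (.reg 7) (.lit 0) (.lit 1)) .skip) .skip) .skip) (by simp [WF, regs])
    (by simpa [Q, State.setReg, hx] using hQ) fun j hj t ht hx ⟨h6, hQ⟩ => ?_
  · refine ⟨this.2.1, this.2.2.1, this.2.2.2.1, this.2.2.2.2.1, fun a b hab => ?_,
      this.2.2.2.2.2.2⟩
    exact this.2.2.2.2.2.1 a b (by omega)
  · obtain ⟨h3, h4, h0, hm, hT, hA⟩ := hQ
    simp only [run, Expr.eval, Expr.eval_vec, hx, h6]
    split_ifs with c1 c2 c3
    · refine ⟨by simpa [State.setReg], by simpa [State.setReg], by simpa [State.setReg], ?_, ?_,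
        ?_, ?_⟩
      · simpa [State.setArr] using h0
      · intro b hb
        have := hm b hb
        simp only [setReg_arr, State.setArr]; grind
      · intro a b hab h1 h2 h3
        have := hT a b
        simp only [setReg_arr, State.setArr]; grind
      · intro A hcl hs b hb
        by_cases hbj : b = j
        · subst hbj
          refine hcl i b (hA A hcl hs i c1) (by rwa [h0] at c2) ?_
          rw [← h3, ← h4]
          by_contra! hcon
          apply c3
          simp [Expr.ne, Expr.eval, h6, hx, ← hcon.1, ← hcon.2]
        · refine hA A hcl hs b ?_
          simpa [State.setArr, hbj] using hb
    all_goals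
      refine ⟨by simpa [State.setReg], by simpa [State.setReg], by simpa [State.setReg], h0, hm,
        fun a b hab h1 h2 hne => ?_, hA⟩
      by_cases hab' : a = i ∧ b = j
      · obtain ⟨rfl, rfl⟩ := hab'
        have := hm _ h1
        rw [← h0] at h2
        simp only [Expr.ne, Expr.eval, h3, h4, h6, hx] at *
        omega
      · exact hT a b (by grind) h1 h2 hne

/-- Array `0` holds the adjacency matrix of `G`, and zeros elsewhere. -/
def HoldsGraph {n : ℕ} (s : State) (G : SimpleGraph (Fin n)) : Prop :=
  ∀ a b, s.arr 0 a b ≠ 0 ↔ ∃ (ha : a < n) (hb : b < n), G.Adj ⟨a, ha⟩ ⟨b, hb⟩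

theorem reach_spec {n N : ℕ} {G : SimpleGraph (Fin n)} {s : State} (hN : s.reg 2 = N) (hnN : n ≤ N)
    (hG : HoldsGraph s G) (u v : Fin n) (hu : s.reg 3 = u) (hv : s.reg 4 = v) :
    (reach.run s).arr 2 v 0 ≠ 0 ↔ ¬ G.IsBridge s(u, v) := by
  classical
  rw [SimpleGraph.isBridge_iff, not_not]
  have huN : (u : ℕ) < N := u.2.trans_le hnN
  let G' := G.deleteEdges {s(u, v)}
  obtain ⟨-, hsound, hcomplete⟩ := run_loop (s := mark.run s) (N := N) (x := 5) (c := relax)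
    ((run_reg (by decide) s).trans hN)
    (fun i t => (t.reg 3 = u ∧ t.reg 4 = v ∧ t.arr 0 = s.arr 0) ∧
      (∀ b, t.arr 2 b 0 ≠ 0 → b < N → ∃ hb : b < n, G'.Reachable u ⟨b, hb⟩) ∧
      ∀ b : Fin n, ∀ w : G'.Walk b u, w.length ≤ i → t.arr 2 b 0 ≠ 0)
    (by simp [WF, regs, relax])
    ⟨⟨by simpa [State.setReg, run_reg (c := mark) (y := 3) (by decide)] using hu,
      by simpa [State.setReg, run_reg (c := mark) (y := 4) (by decide)] using hv,
      by simp [run_arr (c := mark) (a := 0) (by decide)]⟩,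
      fun b hb hbN => by
        rw [setReg_arr, mark_spec hN hbN] at hb
        obtain rfl : b = u := hb.trans hu
        exact ⟨u.2, SimpleGraph.Reachable.refl _⟩,
      fun b w hw => by
        rw [setReg_arr, mark_spec hN (b.2.trans_le hnN), hu,
          SimpleGraph.Walk.eq_of_length_eq_zero (by omega : w.length = 0)]⟩
    (fun i hi t ht hx ⟨⟨h3, h4, h0⟩, hs, hc⟩ => by
      obtain ⟨r1, r2, r3⟩ := relax_spec ht
      refine ⟨⟨by simpa [State.setReg, run_reg (c := relax) (y := 3) (by decide)] using h3,
        by simpa [State.setReg, run_reg (c := relax) (y := 4) (by decide)] using h4,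
        by simpa [run_arr (c := relax) (a := 0) (by decide)] using h0⟩, ?_, ?_⟩
      · refine r3 _ ?_ hs
        intro a b ha hab hne hbN
        rw [h0] at hab
        obtain ⟨ha', hb', hab⟩ := (hG a b).1 hab
        refine ⟨hb', ?_⟩
        obtain ⟨_, hr⟩ := ha (ha'.trans_le hnN)
        by_cases he : s((⟨a, ha'⟩ : Fin n), ⟨b, hb'⟩) = s(u, v)
        · rcases Sym2.eq_iff.1 he with ⟨rfl, rfl⟩ | ⟨rfl, rfl⟩
          · simp [h3, h4] at hne
          · exact SimpleGraph.Reachable.refl _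
        · exact hr.trans (SimpleGraph.Adj.reachable (by simp [G', hab, he]))
      · intro b w hw
        rw [setReg_arr]
        cases w with
        | nil => exact r1 _ (hc u .nil (by simp))
        | @cons _ a _ hba w =>
          have hw' : w.length ≤ i := by simpa using hw
          have hba' := hba
          rw [SimpleGraph.deleteEdges_adj] at hba'
          refine r2 a (a.2.trans_le hnN) b (b.2.trans_le hnN) (hc a w hw') ?_ ?_
          · rw [h0]
            exact (hG a b).2 ⟨a.2, b.2, hba'.1.symm⟩
          · rw [h3, h4]
            by_contra! h
            refine hba'.2 ?_
            rw [Fin.ext h.1, Fin.ext h.2, Sym2.eq_swap]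
            rfl)
  constructor
  · intro h
    exact (hsound v h (v.2.trans_le hnN)).2
  · rintro ⟨w⟩
    refine hcomplete v w.reverse.bypass ?_
    have := w.reverse.bypass_isPath.length_lt
    rw [Fintype.card_fin] at this
    omega

theorem core_spec {n N : ℕ} {G : SimpleGraph (Fin n)} {s : State} (hN : s.reg 2 = N) (hnN : n ≤ N)
    (hG : HoldsGraph s G) (h1 : ∀ a b, s.arr 1 a b = 0) (a b : ℕ) :
    (core.run s).arr 1 a b ≠ 0 ↔ G.coreRel a b := by
  let body : Cmd := .ite (.get 0 (.reg 3) (.reg 4))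
    (.seq reach (.store 1 (.reg 3) (.reg 4) (.vec 2 (.reg 4)))) .skip
  have h := run_loop hN (x := 3) (c := .loop 4 body)
    (fun i t => t.arr 0 = s.arr 0 ∧ ∀ a b, t.arr 1 a b ≠ 0 ↔ a < i ∧ G.coreRel a b)
    (by simp [body, WF, regs, reach, mark, relax]) ⟨rfl, by simp [h1]⟩ fun i hi t ht hx hP => by
      have := run_loop ht (x := 4) (c := body)
        (fun j t => t.reg 3 = i ∧ t.arr 0 = s.arr 0 ∧ ∀ a b,
          t.arr 1 a b ≠ 0 ↔ (a < i ∨ a = i ∧ b < j) ∧ G.coreRel a b)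
        (by simp [body, WF, regs, reach, mark, relax])
        ⟨by simpa [State.setReg] using hx, hP.1, by simpa using hP.2⟩
        fun j hj t ht hx ⟨h3, h0, hP⟩ => by
          have hG' : HoldsGraph t G := by simpa [HoldsGraph, h0] using hG
          refine ⟨by simpa [State.setReg, run_reg (c := body) (y := 3) (by decide)] using h3,
            by simpa [run_arr (c := body) (a := 0) (by decide)] using h0, fun a b => ?_⟩
          rw [setReg_arr]
          simp only [body, run, Expr.eval, h3, hx]
          split_ifs with hij
          · obtain ⟨hi, hj, hadj⟩ := (hG' i j).1 hij
            have hr := reach_spec ht hnN hG' ⟨i, hi⟩ ⟨j, hj⟩ h3 hx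
            simp only [State.setArr, Expr.eval_vec, Expr.eval,
              run_reg (c := reach) (y := 3) (by decide),
              run_reg (c := reach) (y := 4) (by decide),
              run_arr (c := reach) (a := 1) (by decide), h3, hx]
            by_cases hab : a = i ∧ b = j
            · obtain ⟨rfl, rfl⟩ := hab
              have : G.coreRel a b ↔ ¬ G.IsBridge s(⟨a, hi⟩, ⟨b, hj⟩) := by
                simp [SimpleGraph.coreRel, SimpleGraph.core_adj, hi, hj, hadj]
              simp only [true_and, and_self, if_true, this]
              rw [← hr]
              simp
            · have := hP a b
              rw [if_neg (by tauto), this]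
              have : (a < i ∨ a = i ∧ b < j) ↔ (a < i ∨ a = i ∧ b < j + 1) := by omega
              rw [this]
          · have hno : ¬ G.coreRel i j := fun ⟨hi, hj, h⟩ =>
              hij ((hG' i j).2 ⟨hi, hj, (SimpleGraph.core_adj.1 h).1⟩)
            rw [hP a b]
            by_cases hab : a = i ∧ b = j
            · obtain ⟨rfl, rfl⟩ := hab
              tauto
            · have : (a < i ∨ a = i ∧ b < j) ↔ (a < i ∨ a = i ∧ b < j + 1) := by omega
              rw [this]
      refine ⟨this.2.1, fun a b => (this.2.2 a b).trans ?_⟩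
      have : G.coreRel a b → b < N := fun ⟨_, hb, _⟩ => by omega
      have : a < i + 1 ↔ a < i ∨ a = i := by omega
      tauto
  refine (h.2 a b).trans ⟨fun h => h.2, fun h => ⟨?_, h⟩⟩
  obtain ⟨ha, -⟩ := h
  omega

end Cmd
end RAM

/-! ### Running the auction -/

namespace RAM
namespace Cmd

/-- Register `6` receives the successor of the cheapest neighbour, in array `1`, of the content of
register `3`, if this costs less than the limit, and `0` otherwise; prices are in vector `5`. -/
def cheapest : Cmd :=
  .seq (.assign 5 (.reg 2)) <| .seq (.assign 6 (.lit 0)) <|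
  .loop 4 <| .ite (.get 1 (.reg 3) (.reg 4))
    (.ite (.sub (.reg 5) (.vec 5 (.reg 4)))
      (.seq (.assign 5 (.vec 5 (.reg 4))) (.assign 6 (.add (.reg 4) (.lit 1)))) .skip) .skip

/-- The vertex in register `3` takes the vertex whose successor is in register `6` from its mate
and raises its price. -/
def take : Cmd :=
  .seq (.ite (.vec 4 (.sub (.reg 6) (.lit 1)))
    (.store 3 (.sub (.vec 4 (.sub (.reg 6) (.lit 1))) (.lit 1)) (.lit 0) (.lit 0)) .skip) <|
  .seq (.store 4 (.sub (.reg 6) (.lit 1)) (.lit 0) (.add (.reg 3) (.lit 1))) <|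
  .seq (.store 3 (.reg 3) (.lit 0) (.reg 6)) <|
  .store 5 (.sub (.reg 6) (.lit 1)) (.lit 0) (.add (.vec 5 (.sub (.reg 6) (.lit 1))) (.lit 1))

/-- The vertex in register `3` bids if it is not matched. -/
def bid : Cmd := .ite (.vec 3 (.reg 3)) .skip (.seq cheapest (.ite (.reg 6) take .skip))

/-- Enough rounds of bids for the auction to end. -/
def auction : Cmd := .loop 7 (.loop 8 (.loop 3 bid))

theorem cheapest_spec {s : State} {N : ℕ} (hN : s.reg 2 = N) :
    ((cheapest.run s).reg 6 = 0 ∧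
      ∀ v < N, s.arr 1 (s.reg 3) v ≠ 0 → N ≤ s.arr 5 v 0) ∨
    ∃ v, (cheapest.run s).reg 6 = v + 1 ∧ s.arr 1 (s.reg 3) v ≠ 0 ∧
      s.arr 5 v 0 < N ∧ ∀ w < N, s.arr 1 (s.reg 3) w ≠ 0 → s.arr 5 v 0 ≤ s.arr 5 w 0 := by
  have h := run_loop (s := (s.setReg 5 N).setReg 6 0) (N := N) (x := 4)
    (c := .ite (.get 1 (.reg 3) (.reg 4))
      (.ite (.sub (.reg 5) (.vec 5 (.reg 4)))
        (.seq (.assign 5 (.vec 5 (.reg 4))) (.assign 6 (.add (.reg 4) (.lit 1)))) .skip) .skip)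
    (by simpa [State.setReg] using hN)
    (fun i t => t.reg 3 = s.reg 3 ∧ t.arr = s.arr ∧
      ((t.reg 6 = 0 ∧ t.reg 5 = N ∧ ∀ v < i, s.arr 1 (s.reg 3) v ≠ 0 → N ≤ s.arr 5 v 0) ∨
      ∃ v, t.reg 6 = v + 1 ∧ s.arr 1 (s.reg 3) v ≠ 0 ∧ t.reg 5 = s.arr 5 v 0 ∧
        s.arr 5 v 0 < N ∧ ∀ w < i, s.arr 1 (s.reg 3) w ≠ 0 → s.arr 5 v 0 ≤ s.arr 5 w 0))
    (by simp [WF, regs]) (by simp [State.setReg]) fun i hi t ht hx ⟨h3, ha, hP⟩ => by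
      simp only [run, Expr.eval, Expr.eval_vec, h3, ha, hx]
      split_ifs with c1 c2
      · refine ⟨by simpa [State.setReg], by simpa [State.setReg], .inr ⟨i, ?_⟩⟩
        simp only [State.setReg, hx, ha]
        refine ⟨by simp, c1, by simp, ?_⟩
        rcases hP with ⟨-, h5, hP⟩ | ⟨v, -, hv, h5, hvN, hP⟩
        · refine ⟨by omega, fun w hw hne => ?_⟩
          by_cases hwi : w = i
          · rw [hwi]
          · have := hP w (by omega) hne; omega
        · refine ⟨by omega, fun w hw hne => ?_⟩
          by_cases hwi : w = i
          · rw [hwi]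
          · have := hP w (by omega) hne; omega
      all_goals
        refine ⟨by simpa [State.setReg], by simpa [State.setReg], ?_⟩
        simp only [State.setReg, show (6 : ℕ) ≠ 4 by omega, show (5 : ℕ) ≠ 4 by omega, if_false]
        refine hP.imp (fun ⟨h6, h5, h⟩ => ⟨h6, h5, fun v hv hne => ?_⟩)
          fun ⟨v, h6, h, h5, hvN, h'⟩ => ⟨v, h6, h, h5, hvN, fun w hw hne => ?_⟩
      · by_cases hvi : v = i
        · subst hvi; omega
        · exact h v (by omega) hne
      · by_cases hwi : w = i
        · subst hwi; omega
        · exact h' w (by omega) hne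
      · by_cases hvi : v = i
        · subst hvi; exact absurd hne c1
        · exact h v (by omega) hne
      · by_cases hwi : w = i
        · subst hwi; exact absurd hne c1
        · exact h' w (by omega) hne
  simp only [cheapest, run, Expr.eval, hN]
  refine h.2.2.imp (fun h => ⟨h.1, h.2.2⟩) fun ⟨v, h6, h, _, h'⟩ => ⟨v, h6, h, h'⟩

/-- The memory holds the graph `H` in array `1` and an auction on it in the vectors `3`, `4`
and `5`. -/
structure HoldsAuction (H : ℕ → ℕ → Prop) (N : ℕ) (s : State) : Prop where
  graph : ∀ a b, s.arr 1 a b ≠ 0 ↔ H a b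
  auction : Auction H N (s.arr 3 · 0) (s.arr 4 · 0) (s.arr 5 · 0)

/-- The sum of all prices. -/
def prices (N : ℕ) (s : State) : ℕ := ∑ v ∈ Finset.range N, s.arr 5 v 0

theorem bid_spec {H : ℕ → ℕ → Prop} {s : State} {N : ℕ} (hN : s.reg 2 = N)
    (hH : ∀ u v, H u v → v < N) (h : HoldsAuction H N s) :
    HoldsAuction H N (bid.run s) ∧
    ((bid.run s).arr = s.arr ∧
        (s.arr 3 (s.reg 3) 0 = 0 → ∀ v, H (s.reg 3) v → N ≤ s.arr 5 v 0) ∨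
      prices N (bid.run s) = prices N s + 1 ∧ ¬ Auction.Over H N (s.arr 3 · 0) (s.arr 5 · 0)) := by
  have same : ∀ t : State, t.arr = s.arr → HoldsAuction H N t := fun t ht =>
    ⟨by simpa [ht] using h.graph, by simpa [ht] using h.auction⟩
  have ha : (cheapest.run s).arr = s.arr := funext fun a => run_arr (by simp [cheapest, arrs]) s
  by_cases c1 : s.arr 3 (s.reg 3) 0 = 0
  swap
  · rw [show bid.run s = s from run_ite_of_ne (e := .vec 3 (.reg 3)) c1 _ _]
    exact ⟨h, .inl ⟨rfl, fun h0 => absurd h0 c1⟩⟩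
  rcases cheapest_spec hN with ⟨c2, h0⟩ | ⟨v, h6, hv, hvN, hmin⟩
  · rw [show bid.run s = cheapest.run s from 
      (run_ite_of_eq (e := .vec 3 (.reg 3)) c1 _ _).trans (run_ite_of_eq (e := .reg 6) c2 _ _)]
    exact ⟨same _ ha, .inl ⟨ha, fun _ v hv => h0 v (hH _ _ hv) ((h.graph _ _).2 hv)⟩⟩
  · have c2 : (cheapest.run s).reg 6 ≠ 0 := by omega
    rw [show bid.run s = take.run (cheapest.run s) from
      (run_ite_of_eq (e := .vec 3 (.reg 3)) c1 _ _).trans (run_ite_of_ne (e := .reg 6) c2 _ _)]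
    have h3 : (cheapest.run s).reg 3 = s.reg 3 := run_reg (by decide) s
    set t := cheapest.run s
    have huv := (h.graph _ _).1 hv
    have hL : ∀ w, (take.run t).arr 3 w 0 =
        if w = s.reg 3 then v + 1 else if s.arr 4 v 0 = w + 1 then 0 else s.arr 3 w 0 := by
      intro w
      simp only [take, run, Expr.eval, Expr.eval_vec, h6, Nat.add_sub_cancel, ha]
      split_ifs <;> simp [State.setArr, h3, h6, ha] <;> grind
    have hR : ∀ w, (take.run t).arr 4 w 0 = if w = v then s.reg 3 + 1 else s.arr 4 w 0 := by
      intro w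
      simp only [take, run, Expr.eval, Expr.eval_vec, h6, Nat.add_sub_cancel, ha]
      split_ifs <;> simp [State.setArr, h3, h6, ha] <;> grind
    have hp : ∀ w, (take.run t).arr 5 w 0 = if w = v then s.arr 5 v 0 + 1 else s.arr 5 w 0 := by
      intro w
      simp only [take, run, Expr.eval, Expr.eval_vec, h6, Nat.add_sub_cancel, ha]
      split_ifs <;> simp [State.setArr, h3, h6, ha] <;> grind
    refine ⟨⟨?_, ?_⟩, .inr ⟨?_, fun ho => ?_⟩⟩
    · rw [run_arr (c := take) (a := 1) (by decide), ha]
      exact h.graph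
    · exact h.auction.bid c1 huv hvN (fun w hw => hmin w (hH _ _ hw) ((h.graph _ _).2 hw)) hL hR hp
    · exact Auction.sum_bid (hH _ _ huv) hp
    · exact absurd (ho _ v c1 huv) (by simpa using hvN)

/-- A pass in which nobody bids shows that the auction is over; any other pass raises a price. -/
theorem pass_spec {H : ℕ → ℕ → Prop} {s : State} {N : ℕ} (hN : s.reg 2 = N)
    (hH : ∀ u v, H u v → u < N ∧ v < N) (h : HoldsAuction H N s) :
    HoldsAuction H N ((Cmd.loop 3 bid).run s) ∧
    (((Cmd.loop 3 bid).run s).arr = s.arr ∧ Auction.Over H N (s.arr 3 · 0) (s.arr 5 · 0) ∨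
      prices N s + 1 ≤ prices N ((Cmd.loop 3 bid).run s) ∧
        ¬ Auction.Over H N (s.arr 3 · 0) (s.arr 5 · 0)) := by
  have := run_loop hN (x := 3) (c := bid) (fun i t => HoldsAuction H N t ∧
    (t.arr = s.arr ∧ (∀ u < i, s.arr 3 u 0 = 0 → ∀ v, H u v → N ≤ s.arr 5 v 0) ∨
      prices N s + 1 ≤ prices N t ∧ ¬ Auction.Over H N (s.arr 3 · 0) (s.arr 5 · 0)))
    (by simp [WF, bid, cheapest, take, regs]) ⟨⟨h.graph, h.auction⟩, .inl ⟨rfl, by simp⟩⟩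
    fun i hi t ht hx ⟨hA, hP⟩ => by
      obtain ⟨hA', hP'⟩ := bid_spec ht (fun u v h => (hH u v h).2) hA
      refine ⟨⟨hA'.graph, hA'.auction⟩, ?_⟩
      simp only [prices, setReg_arr] at hP hP' ⊢
      rcases hP with ⟨ha, hP⟩ | ⟨hle, hP⟩
      · rw [ha, hx] at hP'
        rcases hP' with ⟨ha', hP'⟩ | ⟨he, hP'⟩
        · refine .inl ⟨ha', fun u hu => ?_⟩
          by_cases hui : u = i
          · exact hui ▸ hP'
          · exact hP u (by omega)
        · exact .inr ⟨he.ge, hP'⟩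
      · refine .inr ⟨?_, hP⟩
        rcases hP' with ⟨ha', -⟩ | ⟨he, -⟩
        · rwa [ha']
        · omega
  refine ⟨this.1, this.2.imp (fun ⟨ha, ho⟩ => ⟨ha, fun u v hu hv => ?_⟩) id⟩
  exact ho u (hH u v hv).1 hu v hv

/-- The auction ends in time: there are `N * N` passes, and the prices never sum up to `N * N`, as
some vertex without neighbours keeps price `0`. -/
theorem auction_spec {H : ℕ → ℕ → Prop} {s : State} {n N : ℕ} (hN : s.reg 2 = N) (hnN : n < N)
    (hH : ∀ u v, H u v → u < n ∧ v < n) (h : HoldsAuction H N s) :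
    HoldsAuction H N (auction.run s) ∧
      Auction.Over H N ((auction.run s).arr 3 · 0) ((auction.run s).arr 5 · 0) ∧
      (auction.run s).arr 5 n 0 = 0 := by
  have hH' : ∀ u v, H u v → u < N ∧ v < N := fun u v h => by have := hH u v h; omega
  have hwf : (Cmd.loop 7 (.loop 8 (.loop 3 bid))).WF := by simp [WF, bid, cheapest, take, regs]
  have := run_loop hN (x := 7) (c := .loop 8 (.loop 3 bid)) (fun i t => HoldsAuction H N t ∧
    (Auction.Over H N (t.arr 3 · 0) (t.arr 5 · 0) ∨ i * N ≤ prices N t))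
    hwf ⟨⟨h.graph, h.auction⟩, .inr (by simp)⟩
    fun i hi t ht hx ⟨hA, hP⟩ => by
      have := run_loop ht (x := 8) (c := .loop 3 bid) (fun j t => HoldsAuction H N t ∧
        (Auction.Over H N (t.arr 3 · 0) (t.arr 5 · 0) ∨ i * N + j ≤ prices N t))
        hwf.2.2.2 ⟨⟨hA.graph, hA.auction⟩, hP⟩ fun j hj t ht hx ⟨hA, hP⟩ => by
          obtain ⟨hA', hP'⟩ := pass_spec ht hH' hA
          refine ⟨⟨hA'.graph, hA'.auction⟩, ?_⟩
          simp only [prices, setReg_arr] at hP hP' ⊢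
          rcases hP' with ⟨ha, ho⟩ | ⟨hle, hno⟩
          · rw [ha]; exact .inl ho
          · exact .inr (by have := hP.resolve_left hno; omega)
      refine ⟨⟨this.1.graph, this.1.auction⟩, ?_⟩
      rw [Nat.succ_mul]
      exact this.2
  have hA := this.1.auction
  have hn : (auction.run s).arr 5 n 0 = 0 := by
    refine hA.free n ?_
    by_contra h0
    obtain ⟨u, hu⟩ := Nat.exists_eq_succ_of_ne_zero h0
    have := hH u n (hA.adj u n ((hA.mate u n).2 hu))
    omega
  refine ⟨this.1, this.2.resolve_right fun hle => ?_, hn⟩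
  -- the vertex `n` keeps price `0` and the others cost at most `N`, so the prices sum up to less
  -- than `N * N`
  have hlt : prices N (auction.run s) < ∑ v ∈ Finset.range N, N :=
    Finset.sum_lt_sum (fun v _ => hA.le v) ⟨n, Finset.mem_range.2 hnN, by omega⟩
  rw [Finset.sum_const, Finset.card_range, smul_eq_mul] at hlt
  exact absurd hle (by simpa [auction] using hlt)

/-- Register `5` receives `0` or `1` according to whether the successor of the content of register
`3` occurs in vector `5`. -/
def missed : Cmd :=
  .seq (.assign 5 (.lit 1)) <|
    .loop 4 (.ite (.ne (.vec 5 (.reg 4)) (.add (.reg 3) (.lit 1))) .skip (.assign 5 (.lit 0)))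

/-- Register `9` receives a positive price level that does not occur in vector `5`. -/
def level : Cmd :=
  .loop 3 <| .seq missed <| .ite (.reg 5) (.assign 9 (.add (.reg 3) (.lit 1))) .skip

theorem missed_spec {s : State} {N : ℕ} (hN : s.reg 2 = N) :
    (missed.run s).reg 5 ≠ 0 ↔ ∀ v < N, s.arr 5 v 0 ≠ s.reg 3 + 1 := by
  have := run_loop (s := s.setReg 5 1) (x := 4) (N := N) (by simpa [State.setReg] using hN)
    (fun j t => t.arr = s.arr ∧ t.reg 3 = s.reg 3 ∧
      (t.reg 5 ≠ 0 ↔ ∀ v < j, s.arr 5 v 0 ≠ s.reg 3 + 1))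
    (c := .ite (.ne (.vec 5 (.reg 4)) (.add (.reg 3) (.lit 1))) .skip (.assign 5 (.lit 0)))
    (by simp [WF, regs]) (by simp [State.setReg]) fun j hj t ht hx ⟨ha, h3, h5⟩ => by
      by_cases c : s.arr 5 j 0 = s.reg 3 + 1
      · rw [run_ite_of_eq (by simp [Expr.eval, ha, h3, hx, c])]
        refine ⟨ha, by simpa [run, State.setReg], ?_⟩
        simp only [run, Expr.eval, State.setReg]
        exact ⟨fun h => absurd rfl h, fun h => absurd c (h j (by omega))⟩
      · rw [run_ite_of_ne (by simpa [Expr.eval, ha, h3, hx] using c)]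
        refine ⟨ha, by simpa [run, State.setReg], ?_⟩
        simp only [run, State.setReg, show (5 : ℕ) ≠ 4 by omega, if_false, h5]
        refine ⟨fun h v hv => ?_, fun h v hv => h v (by omega)⟩
        by_cases hvj : v = j
        · exact hvj ▸ c
        · exact h v (by omega)
  exact this.2.2

theorem level_spec {s : State} {N : ℕ} (hN : s.reg 2 = N)
    (h : ∃ l < N, ∀ v < N, s.arr 5 v 0 ≠ l + 1) :
    (level.run s).reg 9 ≤ N ∧ ∀ v < N, s.arr 5 v 0 ≠ (level.run s).reg 9 := by
  have := run_loop hN (x := 3) (fun i t => t.arr = s.arr ∧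
    ((∀ l < i, ∃ v < N, s.arr 5 v 0 = l + 1) ∨ t.reg 9 ≤ N ∧ ∀ v < N, s.arr 5 v 0 ≠ t.reg 9))
    (c := .seq missed <| .ite (.reg 5) (.assign 9 (.add (.reg 3) (.lit 1))) .skip)
    (by simp [WF, regs, missed]) ⟨rfl, .inl (by simp)⟩ fun i hi t ht hx ⟨ha, hP⟩ => by
      have h5 := missed_spec ht
      have ha' : (missed.run t).arr = s.arr :=
        (funext fun a => run_arr (by simp [missed, arrs]) t).trans ha
      have h3 : (missed.run t).reg 3 = t.reg 3 := run_reg (by decide) t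
      have h9 : (missed.run t).reg 9 = t.reg 9 := run_reg (by decide) t
      rw [ha, hx] at h5
      rw [run]
      by_cases c : (missed.run t).reg 5 = 0
      · rw [run_ite_of_eq (e := .reg 5) c]
        refine ⟨ha', hP.imp (fun h l hl => ?_) fun h => ?_⟩
        · by_cases hli : l = i
          · rw [hli]
            by_contra! hno
            exact h5.2 hno c
          · exact h l (by omega)
        · simpa [run, State.setReg, h9] using h
      · rw [run_ite_of_ne (e := .reg 5) c]
        refine ⟨ha', .inr ?_⟩
        simp only [run, Expr.eval, State.setReg, show (9 : ℕ) ≠ 3 by omega, if_false, if_true, h3,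
          hx]
        exact ⟨hi, h5.1 c⟩
  refine this.2.resolve_left fun hno => ?_
  obtain ⟨l, hl, h⟩ := h
  obtain ⟨v, hv, hvl⟩ := hno l hl
  exact h v hv hvl

end Cmd
end RAM

/-! ### Reading off the vertices of value one half and writing a graph -/

namespace RAM

/-- The value of `v` in the fractional vertex cover read off from the auction in `s` and a price
level `l` that does not occur. -/
def halfValue (s : State) (l v : ℕ) : ℕ :=
  (if l < s.arr 5 v 0 then 1 else 0) +
    if s.arr 3 v 0 ≠ 0 ∧ s.arr 5 (s.arr 3 v 0 - 1) 0 < l then 1 else 0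

namespace Cmd

/-- Register `5` receives the value in the fractional vertex cover of the vertex in register
`3`. -/
def value : Cmd :=
  .seq (.ite (.sub (.vec 5 (.reg 3)) (.reg 9)) (.assign 5 (.lit 1)) (.assign 5 (.lit 0))) <|
  .ite (.vec 3 (.reg 3)) (.ite (.sub (.reg 9) (.vec 5 (.sub (.vec 3 (.reg 3)) (.lit 1))))
    (.assign 5 (.add (.reg 5) (.lit 1))) .skip) .skip

/-- Vector `7` receives the vertices of value `1`, register `10` receives their number, and
register `11` receives the number of vertices of value `2`. -/
def halves : Cmd :=
  .loop 3 <| .seq value <| .ite (.ne (.reg 5) (.lit 1))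
    (.ite (.ne (.reg 5) (.lit 2)) .skip (.assign 11 (.add (.reg 11) (.lit 1))))
    (.seq (.store 7 (.reg 10) (.lit 0) (.reg 3)) (.assign 10 (.add (.reg 10) (.lit 1))))

theorem value_spec (s : State) : (value.run s).reg 5 = halfValue s (s.reg 9) (s.reg 3) := by
  have h1 : ∀ t : State, t.arr = s.arr → t.reg 3 = s.reg 3 → t.reg 9 = s.reg 9 →
      ((Cmd.ite (.vec 3 (.reg 3)) (.ite (.sub (.reg 9) (.vec 5 (.sub (.vec 3 (.reg 3)) (.lit 1))))
        (.assign 5 (.add (.reg 5) (.lit 1))) .skip) .skip).run t).reg 5 = t.reg 5 +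
      if s.arr 3 (s.reg 3) 0 ≠ 0 ∧ s.arr 5 (s.arr 3 (s.reg 3) 0 - 1) 0 < s.reg 9
        then 1 else 0 := by
    intro t ha h3 h9
    by_cases c1 : s.arr 3 (s.reg 3) 0 = 0
    · rw [run_ite_of_eq (by simpa [Expr.eval, ha, h3] using c1)]
      simp [run, c1]
    rw [run_ite_of_ne (by simpa [Expr.eval, ha, h3] using c1)]
    by_cases c2 : s.reg 9 - s.arr 5 (s.arr 3 (s.reg 3) 0 - 1) 0 = 0
    · rw [run_ite_of_eq (by simpa [Expr.eval, ha, h3, h9] using c2), if_neg (by omega)]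
      rfl
    · rw [run_ite_of_ne (by simpa [Expr.eval, ha, h3, h9] using c2), if_pos (by omega)]
      simp [run, State.setReg, Expr.eval]
  rw [value, run, halfValue]
  by_cases c : s.arr 5 (s.reg 3) 0 - s.reg 9 = 0
  · rw [run_ite_of_eq (e := .sub (.vec 5 (.reg 3)) (.reg 9)) c, h1,
      if_neg (by omega : ¬ s.reg 9 < s.arr 5 (s.reg 3) 0)]
    all_goals simp [run, State.setReg, Expr.eval]
  · rw [run_ite_of_ne (e := .sub (.vec 5 (.reg 3)) (.reg 9)) c, h1,
      if_pos (by omega : s.reg 9 < s.arr 5 (s.reg 3) 0)]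
    all_goals simp [run, State.setReg, Expr.eval]

/-- Vector `7` holds an enumeration, of the length in register `10`, of the vertices below `i` with
`x v = 1`, and register `11` holds the number of those with `x v = 2`. -/
structure HoldsHalves (x : ℕ → ℕ) (i : ℕ) (s : State) : Prop where
  sum : s.reg 10 + 2 * s.reg 11 = ∑ v ∈ Finset.range i, x v
  card : s.reg 11 = ((Finset.range i).filter (x · = 2)).card
  mem : ∀ j < s.reg 10, s.arr 7 j 0 < i ∧ x (s.arr 7 j 0) = 1
  inj : Set.InjOn (s.arr 7 · 0) (Set.Iio (s.reg 10))
  surj : ∀ v < i, x v = 1 → ∃ j < s.reg 10, s.arr 7 j 0 = v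

theorem halves_spec {s : State} {N : ℕ} (hN : s.reg 2 = N) (h10 : s.reg 10 = 0)
    (h11 : s.reg 11 = 0) : HoldsHalves (halfValue s (s.reg 9)) N (halves.run s) := by
  set x := halfValue s (s.reg 9) with hxdef
  have hx2 : ∀ v, x v ≤ 2 := by
    intro v; simp only [x, halfValue]; split_ifs <;> omega
  let tail : Cmd := .ite (.ne (.reg 5) (.lit 1))
    (.ite (.ne (.reg 5) (.lit 2)) .skip (.assign 11 (.add (.reg 11) (.lit 1))))
    (.seq (.store 7 (.reg 10) (.lit 0) (.reg 3)) (.assign 10 (.add (.reg 10) (.lit 1))))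
  have := run_loop hN (x := 3) (c := .seq value tail) (fun i t => t.reg 9 = s.reg 9 ∧
      t.arr 3 = s.arr 3 ∧ t.arr 5 = s.arr 5 ∧ HoldsHalves x i t)
    (by simp [tail, value, WF, regs])
    ⟨by simp [State.setReg], rfl, rfl, by constructor <;> simp [State.setReg, h10, h11]⟩
    fun i hi t ht hx ⟨h9, h3, h5, hP⟩ => by
      refine ⟨?_, ?_, ?_, ?_⟩
      · simpa [State.setReg, run_reg (c := .seq value tail) (y := 9) (by decide)] using h9
      · rwa [setReg_arr, run_arr (c := .seq value tail) (a := 3) (by decide)]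
      · rwa [setReg_arr, run_arr (c := .seq value tail) (a := 5) (by decide)]
      rw [run]
      have hv : (value.run t).reg 5 = x i := by
        rw [value_spec, hxdef, halfValue, halfValue, h3, h5, h9, hx]
      have e3 : (value.run t).reg 3 = i := (run_reg (by decide) t).trans hx
      have e10 : (value.run t).reg 10 = t.reg 10 := run_reg (by decide) t
      have e11 : (value.run t).reg 11 = t.reg 11 := run_reg (by decide) t
      have ea : (value.run t).arr = t.arr := funext fun a => run_arr (by simp [value, arrs]) t
      generalize value.run t = r at hv e3 e10 e11 ea
      by_cases c1 : x i = 1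
      · simp only [tail]
        rw [run_ite_of_eq (by simpa [Expr.eval, hv] using c1)]
        simp only [run, Expr.eval]
        constructor
        · simpa [State.setReg, State.setArr, Finset.sum_range_succ, e10, e11, c1, ← hP.sum] using
            by omega
        · simpa [State.setReg, State.setArr, Finset.range_add_one, Finset.filter_insert, e11, c1]
            using hP.card
        · intro j hj
          have hm := hP.mem j
          simp only [State.setReg, State.setArr, e10, e3, ea] at hj ⊢
          grind
        · intro j hj j' hj' hjj
          have hm := hP.mem j
          have hm' := hP.mem j'
          simp only [State.setReg, State.setArr, e10, e3, ea, Set.mem_Iio] at hj hj' hjj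
          by_cases hjm : j = t.reg 10 <;> by_cases hjm' : j' = t.reg 10
          · omega
          · simp [hjm, hjm'] at hjj hj'
            have := hm' (by omega); omega
          · simp [hjm, hjm'] at hjj hj
            have := hm (by omega); omega
          · simp [hjm, hjm'] at hjj hj hj'
            exact hP.inj (Set.mem_Iio.2 (by omega)) (Set.mem_Iio.2 (by omega)) hjj
        · intro v hv h1
          have hs := hP.surj v
          simp only [State.setReg, State.setArr, e10, e3, ea]
          by_cases hvi : v = i
          · exact ⟨t.reg 10, by simp, by simp [hvi]⟩
          · obtain ⟨j, hj, hjv⟩ := hs (by omega) h1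
            refine ⟨j, by simp; omega, ?_⟩
            rw [if_neg (by omega)]
            exact hjv
      · simp only [tail]
        rw [run_ite_of_ne (by simpa [Expr.eval, hv] using c1)]
        have keep : ∀ t' : State, t'.arr = t.arr → t'.reg 10 = t.reg 10 →
            t'.reg 11 = t.reg 11 + (if x i = 2 then 1 else 0) →
            HoldsHalves x (i + 1) (t'.setReg 3 (i + 1)) := by
          intro t' ha' h10' h11'
          have hi2 := hx2 i
          constructor
          · have := hP.sum
            simp only [State.setReg, h10', h11', Finset.sum_range_succ]
            simp only [show (10 : ℕ) ≠ 3 by omega, show (11 : ℕ) ≠ 3 by omega, if_false]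
            split_ifs <;> omega
          · have := hP.card
            simp only [State.setReg, h11', Finset.range_add_one, Finset.filter_insert]
            simp only [show (11 : ℕ) ≠ 3 by omega, if_false]
            split_ifs with c
            · rw [Finset.card_insert_of_notMem (by simp), this]
            · simpa using this
          · intro j hj
            have := hP.mem j (by simpa [State.setReg, h10'] using hj)
            rw [setReg_arr, ha']
            exact ⟨by omega, this.2⟩
          · simpa [State.setReg, h10', ha'] using hP.inj
          · intro v hv h1
            have : v ≠ i := by rintro rfl; exact c1 h1
            simpa [State.setReg, h10', ha'] using hP.surj v (by omega) h1
        by_cases c2 : x i = 2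
        · rw [run_ite_of_eq (by simpa [Expr.eval, hv] using c2)]
          exact keep _ (by simp [run, ea]) (by simp [run, State.setReg, e10])
            (by simp [run, Expr.eval, State.setReg, e11, c2])
        · rw [run_ite_of_ne (by simpa [Expr.eval, hv] using c2)]
          exact keep _ ea e10 (by simp [run, e11, c2])
  exact this.2.2.2

/-- Array `0` receives the values of `e`, which may depend on its position given by the registers
`3` and `4`. -/
def fill (e : Expr) : Cmd := .loop 3 <| .loop 4 <| .store 0 (.reg 3) (.reg 4) e

theorem fill_spec {s : State} {N : ℕ} (hN : s.reg 2 = N) {e : Expr} {g : ℕ → ℕ → ℕ}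
    (he : ∀ t : State, e.eval t = g (t.reg 3) (t.reg 4)) {i j : ℕ} (hi : i < N) (hj : j < N) :
    ((fill e).run s).arr 0 i j = g i j := by
  have := run_loop hN (x := 3) (c := .loop 4 <| .store 0 (.reg 3) (.reg 4) e)
    (fun a t => ∀ i < a, ∀ j < N, t.arr 0 i j = g i j) (by simp [WF, regs]) (by simp)
    fun a ha t ht hx hP => by
      have := run_loop ht (x := 4) (c := .store 0 (.reg 3) (.reg 4) e)
        (fun b t => t.reg 3 = a ∧ ∀ i j, i < a ∧ j < N ∨ i = a ∧ j < b → t.arr 0 i j = g i j)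
        (by simp [WF, regs])
        ⟨by simpa [State.setReg], fun i j hij => hP i (by omega) j (by omega)⟩
        fun b hb t ht hx ⟨h3, hP⟩ => by
          refine ⟨by simpa [State.setReg], fun i j hij => ?_⟩
          have := hP i j
          simp only [run, Expr.eval, setReg_arr, State.setArr, he, h3, hx]
          grind
      exact fun i hi j hj => this.2 i j (by omega)
  exact this i hi j hj

/-- Array `0` receives the edges of the cone over the graph that array `1` induces on the vertices
in vector `7`, whose number is in register `10`. -/
def addCone : Cmd :=
  .loop 3 <| .loop 4 <| .ite (.sub (.reg 10) (.reg 3)) (.ite (.sub (.reg 10) (.reg 4))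
    (.ite (.get 1 (.vec 7 (.reg 3)) (.vec 7 (.reg 4)))
      (.seq (.store 0 (.reg 3) (.reg 4) (.lit 1)) <|
        .seq (.store 0 (.reg 3) (.reg 10) (.lit 1)) (.store 0 (.reg 10) (.reg 3) (.lit 1)))
      .skip) .skip) .skip

theorem addCone_spec {s : State} {N m : ℕ} (hN : s.reg 2 = N) (hm : s.reg 10 = m) (hmN : m < N)
    (h0 : ∀ i ≤ m, ∀ j ≤ m, s.arr 0 i j = 0) {K : ℕ → ℕ → Prop}
    (hK : ∀ a b, K a b ↔ a < m ∧ b < m ∧ s.arr 1 (s.arr 7 a 0) (s.arr 7 b 0) ≠ 0) :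
    ∀ i ≤ m, ∀ j ≤ m, (addCone.run s).arr 0 i j ≤ 1 ∧ ((addCone.run s).arr 0 i j ≠ 0 ↔
      ∃ a b, K a b ∧ (i = a ∧ j = b ∨ i = a ∧ j = m ∨ i = m ∧ j = a)) := by
  let Q : (ℕ → ℕ → Prop) → State → Prop := fun T t =>
    t.reg 10 = m ∧ t.arr 1 = s.arr 1 ∧ t.arr 7 = s.arr 7 ∧
    ∀ i ≤ m, ∀ j ≤ m, t.arr 0 i j ≤ 1 ∧ (t.arr 0 i j ≠ 0 ↔
      ∃ a b, T a b ∧ K a b ∧ (i = a ∧ j = b ∨ i = a ∧ j = m ∨ i = m ∧ j = a))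
  have Qcongr : ∀ {T T' : ℕ → ℕ → Prop} {t : State}, (∀ a b, K a b → (T a b ↔ T' a b)) →
      Q T t → Q T' t := by
    rintro T T' t hT ⟨q1, q2, q3, q4⟩
    refine ⟨q1, q2, q3, fun i hi j hj => ⟨(q4 i hi j hj).1, (q4 i hi j hj).2.trans ?_⟩⟩
    refine exists_congr fun a => exists_congr fun b => ?_
    have := hT a b
    tauto
  have hKN : ∀ a b, K a b → b < N := fun a b h => ((hK a b).1 h).2.1.trans hmN
  let body : Cmd := .ite (.sub (.reg 10) (.reg 3)) (.ite (.sub (.reg 10) (.reg 4))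
    (.ite (.get 1 (.vec 7 (.reg 3)) (.vec 7 (.reg 4)))
      (.seq (.store 0 (.reg 3) (.reg 4) (.lit 1)) <|
        .seq (.store 0 (.reg 3) (.reg 10) (.lit 1)) (.store 0 (.reg 10) (.reg 3) (.lit 1)))
      .skip) .skip) .skip
  have := run_loop hN (x := 3) (c := .loop 4 body) (fun u t => Q (fun a _ => a < u) t)
    (by simp [WF, body, regs])
    ⟨by simpa [State.setReg] using hm, rfl, rfl, fun i hi j hj => by simp [h0 i hi j hj]⟩
    fun u hu t ht hx hQ => by
      suffices h : Q (fun a _ => a < u + 1) ((Cmd.loop 4 body).run t) by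
        simpa [Q, State.setReg] using h
      refine Qcongr (fun a b hab => ?_) (run_loop ht (x := 4) (c := body)
        (fun v t => t.reg 3 = u ∧ Q (fun a b => a < u ∨ a = u ∧ b < v) t)
        (by simp [WF, body, regs]) (by simpa [Q, State.setReg, hx] using hQ)
        fun v hv t ht hx ⟨h3, hQ⟩ => ?_).2
      · have := hKN a b hab; omega
      have hcases : K u v ∧ body.run t = ((t.setArr 0 u v 1).setArr 0 u m 1).setArr 0 m u 1 ∨
          ¬ K u v ∧ body.run t = t := by
        obtain ⟨q1, q2, q3, -⟩ := hQ
        rw [hK]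
        by_cases c1 : m - u = 0
        · exact .inr ⟨by omega, run_ite_of_eq (by simpa [Expr.eval, q1, h3] using c1) _ _⟩
        by_cases c2 : m - v = 0
        · exact .inr ⟨by omega, (run_ite_of_ne (by simpa [Expr.eval, q1, h3] using c1) _ _).trans
            (run_ite_of_eq (by simpa [Expr.eval, q1, hx] using c2) _ _)⟩
        have hb := (run_ite_of_ne (e := .sub (.reg 10) (.reg 3)) (s := t)
          (by simpa [Expr.eval, q1, h3] using c1)
          (.ite (.sub (.reg 10) (.reg 4))
            (.ite (.get 1 (.vec 7 (.reg 3)) (.vec 7 (.reg 4)))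
              (.seq (.store 0 (.reg 3) (.reg 4) (.lit 1)) <|
                .seq (.store 0 (.reg 3) (.reg 10) (.lit 1)) (.store 0 (.reg 10) (.reg 3) (.lit 1)))
              .skip) .skip) .skip).trans
          (run_ite_of_ne (by simpa [Expr.eval, q1, hx] using c2) _ _)
        by_cases c3 : s.arr 1 (s.arr 7 u 0) (s.arr 7 v 0) = 0
        · refine .inr ⟨by tauto, hb.trans (run_ite_of_eq ?_ _ _)⟩
          simpa [Expr.eval, q2, q3, h3, hx] using c3
        · refine .inl ⟨⟨by omega, by omega, c3⟩, hb.trans ((run_ite_of_ne ?_ _ _).trans ?_)⟩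
          · simpa [Expr.eval, q2, q3, h3, hx] using c3
          · simp [run, Expr.eval, h3, hx, q1]
      rcases hcases with ⟨hKuv, hrun⟩ | ⟨hKuv, hrun⟩ <;> rw [hrun]
      · refine ⟨by simpa [State.setReg] using h3, ?_⟩
        obtain ⟨q1, q2, q3, q4⟩ := hQ
        refine ⟨by simpa [State.setReg] using q1, by simpa [State.setArr] using q2,
          by simpa [State.setArr] using q3, fun i hi j hj => ?_⟩
        obtain ⟨h1, h2⟩ := q4 i hi j hj
        have hval : (((((t.setArr 0 u v 1).setArr 0 u m 1).setArr 0 m u 1).setReg 4 (v + 1)).arr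
            0 i j) = if i = u ∧ j = v ∨ i = u ∧ j = m ∨ i = m ∧ j = u then 1
              else t.arr 0 i j := by
          simp only [setReg_arr, State.setArr, true_and]
          grind
        rw [hval]
        split_ifs with c
        · refine ⟨le_rfl, fun _ => ⟨u, v, .inr ⟨rfl, by omega⟩, hKuv, c⟩, fun _ => by simp⟩
        · refine ⟨h1, h2.trans (exists_congr fun a => exists_congr fun b => ?_)⟩
          have : ¬ (a = u ∧ b = v ∧ (i = a ∧ j = b ∨ i = a ∧ j = m ∨ i = m ∧ j = a)) := by
            rintro ⟨rfl, rfl, h⟩; exact c h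
          constructor
          · rintro ⟨h, hk, hc⟩
            exact ⟨by omega, hk, hc⟩
          · rintro ⟨h, hk, hc⟩
            refine ⟨?_, hk, hc⟩
            by_contra hn
            exact this ⟨by omega, by omega, hc⟩
      · refine ⟨by simpa [State.setReg] using h3, Qcongr (T := fun a b => a < u ∨ a = u ∧ b < v) ?_
          (by simpa [Q, State.setReg] using hQ)⟩
        intro a b hab
        have : ¬ (a = u ∧ b = v) := by rintro ⟨rfl, rfl⟩; exact hKuv hab
        omega
  obtain ⟨-, -, -, h⟩ := this
  refine fun i hi j hj => ⟨(h i hi j hj).1, (h i hi j hj).2.trans ?_⟩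
  refine exists_congr fun a => exists_congr fun b => ?_
  have : K a b → a < N := fun h => ((hK a b).1 h).1.trans hmN
  tauto

end Cmd
end RAM

/-! ### The kernelization -/

namespace RAM
namespace Cmd

/-- Outputs the triangle with parameter `0`. -/
def outputNo : Cmd :=
  .seq (.assign 0 (.lit 3)) <| .seq (.assign 1 (.lit 0)) <|
    fill (.sub (.lit 1) (.sub (.lit 1) (.ne (.reg 3) (.reg 4))))

/-- Outputs the cone over the graph on the vertices of value `1`, with one more vertex allowed. -/
def outputCone : Cmd :=
  .seq (.assign 0 (.add (.reg 10) (.lit 1))) <|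
  .seq (.assign 1 (.sub (.add (.reg 1) (.lit 1)) (.reg 11))) <|
  .seq (fill (.lit 0)) addCone

/-- The kernelization, once register `2` is set. -/
def kernelize : Cmd :=
  .seq core <| .seq auction <| .seq level <| .seq halves <|
    .ite (.sub (.add (.reg 10) (.add (.reg 11) (.reg 11))) (.add (.reg 1) (.reg 1)))
      outputNo outputCone

theorem outputNo_outputs {s : State} {N : ℕ} (hN : s.reg 2 = N) (h3 : 3 ≤ N) :
    Outputs (outputNo.run s) ⟨3, ⊤, 0⟩ := by
  let s' := (s.setReg 0 3).setReg 1 0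
  have hrun : outputNo.run s =
    (fill (.sub (.lit 1) (.sub (.lit 1) (.ne (.reg 3) (.reg 4))))).run s' := rfl
  rw [hrun]
  refine ⟨(run_reg (by decide) s').trans (by simp [s', State.setReg]),
    (run_reg (by decide) s').trans (by simp [s', State.setReg]), fun i j => ?_⟩
  have hg := fill_spec (s := s') (N := N) (by simpa [s', State.setReg] using hN)
    (e := .sub (.lit 1) (.sub (.lit 1) (.ne (.reg 3) (.reg 4))))
    (g := fun a b => if a = b then 0 else 1) (i := i) (j := j)
    (fun t => by simp only [Expr.eval, Expr.ne]; split_ifs <;> omega)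
    (lt_of_lt_of_le i.2 h3) (lt_of_lt_of_le j.2 h3)
  rw [hg]
  simp [Fin.ext_iff]

theorem outputCone_outputs {s : State} {N m c k : ℕ} {H : ℕ → ℕ → Prop} (hN : s.reg 2 = N)
    (hm : s.reg 10 = m) (hc : s.reg 11 = c) (hk : s.reg 1 = k) (hmN : m < N)
    (hs : ∀ u v, H u v → H v u) (hi : ∀ u, ¬ H u u)
    (hH : ∀ a b, s.arr 1 (s.arr 7 a 0) (s.arr 7 b 0) ≠ 0 ↔ H a b) :
    Outputs (outputCone.run s) ⟨m + 1, SimpleGraph.cone H m, k + 1 - c⟩ := by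
  let s' := (s.setReg 0 (m + 1)).setReg 1 (k + 1 - c)
  let s'' := (fill (.lit 0)).run s'
  have hrun : outputCone.run s = addCone.run s'' := by
    simp [outputCone, run, Expr.eval, hm, hc, hk, State.setReg, s', s'']
  have hreg : ∀ x, x ≠ 0 → x ≠ 1 → x ≠ 3 → x ≠ 4 → s''.reg x = s.reg x := fun x h0 h1 h3 h4 =>
    (run_reg (by simp [fill, regs, h3, h4]) s').trans (by simp [s', State.setReg, h0, h1])
  have harr : ∀ a, a ≠ 0 → s''.arr a = s.arr a := fun a h0 =>
    (run_arr (by simp [fill, arrs, h0]) s').trans rfl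
  have hz : ∀ i ≤ m, ∀ j ≤ m, s''.arr 0 i j = 0 := fun i hi j hj =>
    fill_spec (s := s') (N := N) (by simpa [s', State.setReg] using hN) (e := .lit 0)
      (g := fun _ _ => 0) (fun _ => rfl) (by omega) (by omega)
  have hspec := addCone_spec (s := s'')
    ((hreg 2 (by omega) (by omega) (by omega) (by omega)).trans hN)
    ((hreg 10 (by omega) (by omega) (by omega) (by omega)).trans hm) hmN hz
    (K := fun a b => a < m ∧ b < m ∧ H a b)
    (fun a b => by rw [harr 1 (by omega), harr 7 (by omega), hH])
  rw [hrun]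
  refine ⟨(run_reg (by decide) s'').trans ?_, (run_reg (by decide) s'').trans ?_, fun i j => ?_⟩
  · exact (run_reg (by decide) s').trans (by simp [s', State.setReg])
  · exact (run_reg (by decide) s').trans (by simp [s', State.setReg])
  · obtain ⟨hle, hne⟩ := hspec i (Nat.lt_succ_iff.1 i.2) j (Nat.lt_succ_iff.1 j.2)
    have hadj : (SimpleGraph.cone H m).Adj i j ↔ ∃ a b, (a < m ∧ b < m ∧ H a b) ∧
        ((i : ℕ) = a ∧ (j : ℕ) = b ∨ (i : ℕ) = a ∧ (j : ℕ) = m ∨ (i : ℕ) = m ∧ (j : ℕ) = a) := by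
      rw [SimpleGraph.cone_adj hs hi]
      constructor
      · rintro (⟨h1, h2, h3⟩ | ⟨h1, h2, b, h3, h4⟩ | ⟨h1, h2, b, h3, h4⟩)
        · exact ⟨i, j, ⟨h1, h2, h3⟩, .inl ⟨rfl, rfl⟩⟩
        · exact ⟨i, b, ⟨h1, h3, h4⟩, .inr (.inl ⟨rfl, h2⟩)⟩
        · exact ⟨j, b, ⟨h1, h3, h4⟩, .inr (.inr ⟨h2, rfl⟩)⟩
      · rintro ⟨a, b, ⟨h1, h2, h3⟩, (⟨rfl, rfl⟩ | ⟨rfl, h⟩ | ⟨h, rfl⟩)⟩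
        · exact .inl ⟨h1, h2, h3⟩
        · exact .inr (.inl ⟨h1, h, b, h2, h3⟩)
        · exact .inr (.inr ⟨h1, h, b, h2, h3⟩)
    rw [← hadj] at hne
    dsimp only
    split_ifs with h
    · have := hne.2 h
      omega
    · exact not_not.1 (mt hne.1 h)

/-- What the algorithm has found out before it writes its output: a minimum fractional vertex cover
of the edges that are no bridges, with the list of the vertices of value `1`. -/
theorem exists_halfCover (I : IdfInstance) {s : State} (hs : s = (input I).setReg 2 (I.n + 3)) :
    ∃ x, IsHalfCover I.G.coreRel (I.n + 3) x ∧
      HoldsHalves x (I.n + 3) (halves.run (level.run (auction.run (core.run s)))) := by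
  have hN : s.reg 2 = I.n + 3 := by simp [hs, State.setReg]
  have harr : s.arr = (input I).arr := by rw [hs]; rfl
  have h10 : s.reg 10 = 0 ∧ s.reg 11 = 0 := by simp [hs, State.setReg, input]
  have hG : HoldsGraph s I.G := by
    intro a b
    simp [harr, input]
  have hH : ∀ u v, I.G.coreRel u v → u < I.n ∧ v < I.n := fun u v ⟨hu, hv, _⟩ => ⟨hu, hv⟩
  have hA : HoldsAuction I.G.coreRel (I.n + 3) (core.run s) := by
    refine ⟨core_spec hN (by omega) hG (by simp [harr, input]), ?_⟩
    have : ∀ a ∈ [3, 4, 5], ((core.run s).arr a · 0) = fun _ => 0 := by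
      intro a ha
      rw [run_arr (by revert a; decide), harr]
      funext v
      have : a ≠ 0 := by rintro rfl; simp at ha
      simp [input, this]
    rw [this 3 (by simp), this 4 (by simp), this 5 (by simp)]
    exact Auction.init _ _
  have hN1 : (core.run s).reg 2 = I.n + 3 := (run_reg (by decide) s).trans hN
  obtain ⟨hA', hover, hn⟩ := auction_spec hN1 (n := I.n) (by omega) hH hA
  set s₂ := auction.run (core.run s) with hs₂
  have hN2 : s₂.reg 2 = I.n + 3 := (run_reg (by decide) _).trans hN1
  obtain ⟨hl, hlev⟩ := level_spec hN2 (Auction.exists_level (by omega) hn)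
  have hhalf := hA'.auction.isHalfCover hover (fun u v => SimpleGraph.coreRel_symm)
    (fun u v h => by have := (hH u v h).2; omega) hl hlev
  have hN3 : (level.run s₂).reg 2 = I.n + 3 := (run_reg (by decide) _).trans hN2
  have hv := halves_spec hN3
    (by simp only [hs₂]; rw [run_reg (by decide), run_reg (by decide), run_reg (by decide), h10.1])
    (by simp only [hs₂]; rw [run_reg (by decide), run_reg (by decide), run_reg (by decide), h10.2])
  refine ⟨_, ?_, hv⟩
  convert! hhalf using 1
  funext v
  rw [halfValue, run_arr (c := level) (a := 3) (by decide),
    run_arr (c := level) (a := 5) (by decide)]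

theorem kernelize_spec (I : IdfInstance) : ∃ J : IdfInstance,
    Outputs (kernelize.run ((input I).setReg 2 (I.n + 3))) J ∧ (I.IsYes ↔ J.IsYes) ∧
      J.k ≤ I.k + 1 ∧ (I.k ≠ 0 ∨ I.G.IsAcyclic → J.n ≤ 2 * I.k + 1) ∧
      J.n ≤ max 3 (2 * I.k + 1) := by
  obtain ⟨x, hx, hh⟩ := exists_halfCover I rfl
  have hH : ∀ u v, I.G.coreRel u v → u < I.n ∧ v < I.n := fun u v ⟨hu, hv, _⟩ => ⟨hu, hv⟩
  have hyes : I.IsYes ↔ HasCover I.G.coreRel I.k := SimpleGraph.hasForestIdentification_iff_hasCover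
  set s := (input I).setReg 2 (I.n + 3) with hs
  set t := halves.run (level.run (auction.run (core.run s))) with ht
  have hreg : ∀ y ∈ [1, 2], t.reg y = s.reg y := by
    intro y hy
    rw [ht, run_reg (by revert y; decide), run_reg (by revert y; decide),
      run_reg (by revert y; decide), run_reg (by revert y; decide)]
  have hk : t.reg 1 = I.k := (hreg 1 (by simp)).trans (by simp [hs, State.setReg, input])
  have hN : t.reg 2 = I.n + 3 := (hreg 2 (by simp)).trans (by simp [hs, State.setReg])
  have hsum := hh.sum
  have hrun : kernelize.run s = (Cmd.ite (.sub (.add (.reg 10) (.add (.reg 11) (.reg 11)))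
      (.add (.reg 1) (.reg 1))) outputNo outputCone).run t := rfl
  by_cases hbig : ∑ v ∈ Finset.range (I.n + 3), x v ≤ 2 * I.k
  · set m := t.reg 10 with hm
    set c := t.reg 11 with hc
    have ht1 : t.arr 1 = (core.run s).arr 1 := by
      rw [ht, run_arr (by decide), run_arr (by decide), run_arr (by decide)]
    have hcore : ∀ a b, t.arr 1 a b ≠ 0 ↔ I.G.coreRel a b := by
      rw [ht1]
      exact core_spec (N := I.n + 3) (by simp [hs, State.setReg]) (by omega)
        (fun a b => by simp [hs, State.setReg, input]) (by simp [hs, State.setReg, input])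
    have hmN : m < I.n + 3 := by
      -- only the vertices below `I.n` can have a neighbour
      have hmaps : ∀ j ∈ Finset.range m, t.arr 7 j 0 ∈ Finset.range I.n := fun j hj => by
        obtain ⟨h1, h2⟩ := hh.mem j (Finset.mem_range.1 hj)
        rw [Finset.mem_range]
        by_contra hn
        have := hx.eq_zero h1 fun u w huw => by have := hH u w huw; omega
        omega
      have := Finset.card_le_card_of_injOn _ hmaps
        (hh.inj.mono fun j hj => by simpa using hj)
      simp only [Finset.card_range] at this
      omega
    let H : ℕ → ℕ → Prop := fun a b => I.G.coreRel (t.arr 7 a 0) (t.arr 7 b 0)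
    have hs' : ∀ u v, H u v → H v u := fun u v => SimpleGraph.coreRel_symm
    have hi : ∀ u, ¬ H u u := fun u ⟨_, _, h⟩ => h.ne rfl
    refine ⟨⟨m + 1, SimpleGraph.cone H m, I.k + 1 - c⟩, ?_, ?_, ?_⟩
    · rw [hrun, run_ite_of_eq (by simp only [Expr.eval, hk]; omega)]
      exact outputCone_outputs hN rfl rfl hk hmN hs' hi fun a b => hcore _ _
    · rw [hyes]
      change _ ↔ (SimpleGraph.cone H m).HasForestIdentification (I.k + 1 - c)
      rw [show I.k + 1 - c = I.k - c + 1 by omega,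
        SimpleGraph.cone_hasForestIdentification_iff hs' hi]
      have hnt := hx.hasCover_iff (fun u v h => by have := hH u v h; omega) (k := I.k - c)
      rw [← hh.card, ← hc, show I.k - c + c = I.k by omega] at hnt
      rw [hnt, ← hasCover_comp_iff (f := (t.arr 7 · 0)) hh.inj fun u v ⟨h, hu, hv⟩ =>
        ⟨hh.surj u (by have := hH u v h; omega) hu, hh.surj v (by have := hH u v h; omega) hv⟩]
      have : ∀ a b, (a < m ∧ b < m ∧ H a b ∧ x (t.arr 7 a 0) = 1 ∧ x (t.arr 7 b 0) = 1) ↔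
          a < m ∧ b < m ∧ H a b := fun a b =>
        ⟨fun h => ⟨h.1, h.2.1, h.2.2.1⟩, fun h =>
          ⟨h.1, h.2.1, h.2.2, (hh.mem a h.1).2, (hh.mem b h.2.1).2⟩⟩
      simp only [H] at this ⊢
      simp only [← hm, this]
    · dsimp only
      omega
  · have hno : ¬ I.IsYes := fun h => hbig (hx.sum_le (hyes.1 h))
    refine ⟨⟨3, ⊤, 0⟩, ?_, ?_, by simp, fun h => ?_, by simp⟩
    · rw [hrun, run_ite_of_ne (by simp only [Expr.eval, hk]; omega)]
      exact outputNo_outputs hN (by omega)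
    · exact iff_of_false hno SimpleGraph.not_hasForestIdentification_triangle
    · rcases h with h | h
      · dsimp only
        omega
      · refine absurd (hyes.2 ⟨∅, by simp, fun u v ⟨hu, hv, h'⟩ => ?_⟩) hno
        rw [SimpleGraph.core_adj] at h'
        exact absurd (SimpleGraph.isAcyclic_iff_forall_adj_isBridge.1 h h'.1) h'.2

theorem kernelize_wf : kernelize.WF ∧ 2 ∉ kernelize.regs := by
  simp [kernelize, core, reach, mark, relax, auction, bid, cheapest, take, level, missed, halves,
    value, outputNo, outputCone, fill, addCone, WF, regs]

end Cmd
end RAM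

theorem theorem1 :
    ∃ f : IdfInstance → IdfInstance, RAM.PolyTimeComputable f ∧
      ∀ I : IdfInstance,
        (I.IsYes ↔ (f I).IsYes) ∧
        (f I).k ≤ I.k + 1 ∧
        (I.k ≠ 0 ∨ I.G.IsAcyclic → (f I).n ≤ 2 * I.k + 1) ∧
        (I.k = 0 → ¬ I.G.IsAcyclic → (f I).n ≤ 3) := by
  choose f hout hyes hk hn hn' using RAM.Cmd.kernelize_spec
  refine ⟨f, ⟨.seq (.assign 2 (.add (.reg 0) (.lit 3))) RAM.Cmd.kernelize.toProg,
    4 + RAM.Cmd.kernelize.time.comp (.X + 3), fun I => ?_⟩,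
    fun I => ⟨hyes I, hk I, hn I, fun h0 _ => ?_⟩⟩
  · obtain ⟨hwf, h2⟩ := RAM.Cmd.kernelize_wf
    obtain ⟨t, ht, he⟩ := RAM.Cmd.exec hwf (s := (RAM.input I).setReg 2 (I.n + 3))
      (N := I.size + 3) (by simp [RAM.State.setReg, IdfInstance.size]) h2
    refine ⟨4 + t, _, .seq (RAM.Exec.assign (RAM.input I) 2 (.add (.reg 0) (.lit 3))) he, ?_,
      hout I⟩
    simpa using ht
  · simpa [h0] using hn' I
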